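/- **Setting.** Let $\mathcal{X}\subset\mathbb{R}^d$ and let $\mathcal{H}$ be a reproducing kernel Hilbert space of real (measurable) functions on $\mathcal{X}$ with inner product $\langle\cdot,\cdot\rangle_{\mathcal H}$. Fix $M\ge 0$. For $m=0$ (target) and $m=1,\dots,M$ (sources) let $(Y^{(m)},X^{(m)})\in\mathbb{R}\times\mathcal{X}$ and let $(Y^{(m)}_1,X^{(m)}_1),(Y^{(m)}_2,X^{(m)}_2),\dots$ be i.i.d. copies of it. Assume *covariate shift*: the conditional distribution of $Y^{(m)}$ given $X^{(m)}=x$ is the same for all $m$ (the laws of $X^{(m)}$ may differ), and the common conditional mean $f_*(x)=\mathbb{E}[Y^{(m)}\mid X^{(m)}=x]$ belongs to $\mathcal{H}$. Put $e^{(m)}=Y^{(m)}-f_*(X^{(m)})$ and $e^{(m)}_i=Y^{(m)}_i-f_*(X^{(m)}_i)$. The weights $\omega^{(m)}_i$ are either all equal to $1$, or i.i.d. (over all $m,i$), bounded, positive, with mean one and variance one, and independent of the data. For sample sizes $n_0,\dots,n_M$ with $n=\sum_m n_m$ and for $\lambda>0$ let $$\widehat f=\operatorname*{argmin}_{f\in\mathcal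 H}\Big\{\frac1{2n}\sum_{m=0}^M\sum_{i=1}^{n_m}\omega^{(m)}_i|Y^{(m)}_i-f(X^{(m)}_i)|^2+\frac\lambda2\|f\|_{\mathcal H}^2\Big\}.$$ Let $V_m(f,g)=\mathbb{E}[f(X^{(m)})g(X^{(m)})]$, $V=\frac1n\sum_m n_mV_m$, $\langle f,g\rangle=V(f,g)+\lambda\langle f,g\rangle_{\mathcal H}$, $\|f\|=\langle f,f\rangle^{1/2}$. Let $K$ be the reproducing kernel of $(\mathcal H,\langle\cdot,\cdot\rangle)$, i.e. $\langle K_x,f\rangle=f(x)$ for all $f\in\mathcal H$, and let $\mathcal P_\lambda$ be given by $\langle\mathcal P_\lambda f,g\rangle=\lambda\langle f,g\rangle_{\mathcal H}$ for all $f,g\in\mathcal H$. **Assumptions.** (A1) There is $b\ge1$ with $b^{-1}V_0(f,f)\le V_m(f,f)\le bV_0(f,f)$ for all $1\le m\le M$ and $f\in\mathcal H$. (A2) There are a basis $\{\varphi_\nu\}_{\nu\ge1}$ of $\mathcal H$ (its linear span is dense), uniformly bounded over $\mathcal X$, and a non-decreasing positive sequence $\{\rho_\nu\}_{\nu\ge1}$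 with $V_0(\varphi_\nu,\varphi_\mu)=\delta_{\nu\mu}$ and $\langle\varphi_\nu,\varphi_\mu\rangle_{\mathcal H}=\rho_\nu\delta_{\nu\mu}$. (A3) For each $m=0,\dots,M$ there is $C_m>0$ with $C_m^{-1}\le\mathbb{E}[|e^{(m)}|^2\mid X^{(m)}]\le C_m$ and $\mathbb{E}[|e^{(m)}|^4\mid X^{(m)}]\le C_m$ almost surely. Define $h$ by $h^{-1}=\sum_{\nu\ge1}(1+\lambda\rho_\nu)^{-1}$ ($h=0$ if the series diverges). Fix a constant $c_1>0$, let $\mathcal F=\{f\in\mathcal H:\|f\|\le c_1^{-1}h^{1/2}\}$, and put $$a_\lambda=\int_0^1\psi_2^{-1}\big(D(\mathcal F,\varepsilon,\|\cdot\|_\infty)\big)\,d\varepsilon\in[0,\infty],\qquad\psi_2(x)=e^{x^2}-1,$$ where $D(\mathcal F,\varepsilon,\|\cdot\|_\infty)$ is the $\varepsilon$-covering number of $\mathcal F$ for the supremum norm. **Theorem (convergence rate under covariate shift).** Keep $M$, $\mathcal H$ and the populations fixed, and let the sample sizes $n_m$ and $\lambda>0$ vary along a sequence with $n\to\infty$ (so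 $h$, $\|\cdot\|$, $K$, $\mathcal P_\lambda$, $\mathcal F$, $a_\lambda$ vary too). If (A1), (A2), (A3) hold and $a_\lambda=o(\sqrt{nh^2})$ (that is, $a_\lambda/\sqrt{nh^2}\to0$, where a quotient with denominator $0$ counts as $\infty$), then $$\|\widehat f-f_*\|=O_{\mathbb P}\Big(\frac1{\sqrt{nh}}+\sqrt\lambda\Big),$$ $$\|\widehat f-f_*+S(f_*)\|=O_{\mathbb P}\Big(\frac{a_\lambda}{\sqrt{nh^2}}\Big(\frac1{\sqrt{nh}}+\sqrt\lambda\Big)\Big),$$ where $$S(f_*)=-\frac1n\sum_{m=0}^M\sum_{i=1}^{n_m}\omega^{(m)}_ie^{(m)}_iK_{X^{(m)}_i}+\mathcal P_\lambda f_*.$$ -/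

import Mathlib

open MeasureTheory ProbabilityTheory Filter Topology
open scoped ENNReal NNReal

/-! Pooled weighted kernel ridge regression over one target population (index `0`) and `M` source
populations (indices `1, …, M`), with a reproducing kernel Hilbert space `H` of functions on `X`. -/

namespace PooledKRR

noncomputable section

/-! ### Quadratic forms, pooled inner product, reproducing kernel, and the operator `𝒫_λ` -/

section Forms

variable {X H : Type*} [MeasurableSpace X] [NormedAddCommGroup H] [InnerProductSpace ℝ H]
  [RKHS ℝ H X ℝ] {M : ℕ}

/-- `V_m(f, g) = E[f(X⁽ᵐ⁾) g(X⁽ᵐ⁾)]`, where `μ` is the law of `X⁽ᵐ⁾`. -/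
def quadForm (μ : Measure X) (f g : H) : ℝ := ∫ x, f x * g x ∂μ

/-- Total sample size `n = ∑ₘ nₘ`. -/
def totalSize (n : Fin (M + 1) → ℕ) : ℕ := ∑ m, n m

/-- `V(f, g) = n⁻¹ ∑ₘ nₘ V_m(f, g)`. -/
def pooledForm (μ : Fin (M + 1) → Measure X) (n : Fin (M + 1) → ℕ) (f g : H) : ℝ :=
  (totalSize n : ℝ)⁻¹ * ∑ m, (n m : ℝ) * quadForm (μ m) f g

/-- `⟨f, g⟩ = V(f, g) + λ ⟨f, g⟩_H`. -/
def pooledInner (μ : Fin (M + 1) → Measure X) (n : Fin (M + 1) → ℕ) (lam : ℝ) (f g : H) : ℝ :=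
  pooledForm μ n f g + lam * inner ℝ f g

/-- `‖f‖ = ⟨f, f⟩^{1/2}`. -/
def pooledNorm (μ : Fin (M + 1) → Measure X) (n : Fin (M + 1) → ℕ) (lam : ℝ) (f : H) : ℝ :=
  √(pooledInner μ n lam f f)

/-- The section `K_x ∈ H` of the reproducing kernel of `(H, ⟨·,·⟩)`: the element with
`⟨K_x, f⟩ = f(x)` for all `f ∈ H`. -/
def pooledKernel (μ : Fin (M + 1) → Measure X) (n : Fin (M + 1) → ℕ) (lam : ℝ) (x : X) : H :=
  Classical.epsilon fun k : H => ∀ f : H, pooledInner μ n lam k f = f x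

/-- `𝒫_λ f`: the element of `H` with `⟨𝒫_λ f, g⟩ = λ ⟨f, g⟩_H` for all `g ∈ H`. -/
def penaltyOp (μ : Fin (M + 1) → Measure X) (n : Fin (M + 1) → ℕ) (lam : ℝ) (f : H) : H :=
  Classical.epsilon fun p : H => ∀ g : H, pooledInner μ n lam p g = lam * inner ℝ f g

/-! ### Assumptions -/

/-- Uniform equivalence of the quadratic forms. -/
def UniformEquivalence (H : Type*) [NormedAddCommGroup H] [InnerProductSpace ℝ H]
    [RKHS ℝ H X ℝ] (μ : Fin (M + 1) → Measure X) : Prop :=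
  ∃ b : ℝ, 1 ≤ b ∧ ∀ m : Fin (M + 1), m ≠ 0 → ∀ f : H,
    b⁻¹ * quadForm (μ 0) f f ≤ quadForm (μ m) f f ∧
      quadForm (μ m) f f ≤ b * quadForm (μ 0) f f

/-- Simultaneous diagonalization of `V_0` and `⟨·,·⟩_H` by a basis `φ_ν` of `H` which is uniformly
bounded over `X`, with a non-decreasing positive sequence `ρ_ν`. -/
structure SimultaneousDiagonalization (μ₀ : Measure X) (φ : ℕ → H) (ρ : ℕ → ℝ) : Prop where
  pos : ∀ ν, 0 < ρ ν
  mono : Monotone ρ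
  basis : (Submodule.span ℝ (Set.range φ)).topologicalClosure = ⊤
  form : ∀ ν ν', quadForm μ₀ (φ ν) (φ ν') = if ν = ν' then 1 else 0
  inner : ∀ ν ν', inner ℝ (φ ν) (φ ν') = if ν = ν' then ρ ν else 0
  bounded : ∃ B : ℝ, ∀ ν x, |φ ν x| ≤ B

/-- Moment condition on the errors `e⁽ᵐ⁾ = Y⁽ᵐ⁾ - f(X⁽ᵐ⁾)`, where `κ x` is the conditional law of
the response given that the covariate equals `x`, and `μ m` is the law of `X⁽ᵐ⁾`. -/
def MomentCondition (μ : Fin (M + 1) → Measure X) (κ : Kernel X ℝ) (f : H) : Prop :=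
  ∀ m, ∃ C : ℝ, 0 < C ∧ ∀ᵐ x ∂(μ m),
    ENNReal.ofReal C⁻¹ ≤ ∫⁻ y, ENNReal.ofReal (|y - f x| ^ 2) ∂(κ x) ∧
    ∫⁻ y, ENNReal.ofReal (|y - f x| ^ 2) ∂(κ x) ≤ ENNReal.ofReal C ∧
    ∫⁻ y, ENNReal.ofReal (|y - f x| ^ 4) ∂(κ x) ≤ ENNReal.ofReal C

/-- `f` is the conditional mean function of every population. -/
def IsCondMean (μ : Fin (M + 1) → Measure X) (κ : Kernel X ℝ) (f : H) : Prop :=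
  ∀ m, ∀ᵐ x ∂(μ m), f x = ∫ y, y ∂(κ x)

/-- Data under covariate shift: for each `m`, the pairs `(X m i, Y m i)`, `i = 0, 1, …`, are
i.i.d., the law of the covariate is `μ m`, and the conditional law of the response given the
covariate is the same Markov kernel `κ` for all `m`. -/
structure IsCovariateShiftData {Ω : Type*} [MeasurableSpace Ω] (P : Measure Ω)
    (μ : Fin (M + 1) → Measure X) (κ : Kernel X ℝ)
    (Xs : Fin (M + 1) → ℕ → Ω → X) (Ys : Fin (M + 1) → ℕ → Ω → ℝ) : Prop where
  measurable_X : ∀ m i, Measurable (Xs m i)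
  measurable_Y : ∀ m i, Measurable (Ys m i)
  law : ∀ m i, P.map (fun o => (Xs m i o, Ys m i o)) = (μ m) ⊗ₘ κ
  indep : ∀ m, iIndepFun (fun i o => (Xs m i o, Ys m i o)) P

/-- The two cases for the weights: all equal to one, or i.i.d., positive, bounded, with mean one
and variance one, and independent of the data. -/
def IsAdmissibleWeights {Ω : Type*} [MeasurableSpace Ω] (P : Measure Ω)
    (W : Fin (M + 1) → ℕ → Ω → ℝ)
    (Xs : Fin (M + 1) → ℕ → Ω → X) (Ys : Fin (M + 1) → ℕ → Ω → ℝ) : Prop :=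
  (∀ m i o, W m i o = 1) ∨
  ((∀ m i, Measurable (W m i)) ∧
    iIndepFun (fun p : Fin (M + 1) × ℕ => W p.1 p.2) P ∧
    (∀ m i, IdentDistrib (W m i) (W 0 0) P P) ∧
    (∃ c : ℝ, ∀ m i, ∀ᵐ o ∂P, 0 < W m i o ∧ W m i o ≤ c) ∧
    (∀ m i, ∫ o, W m i o ∂P = 1) ∧
    (∀ m i, variance (W m i) P = 1) ∧
    IndepFun (fun o (p : Fin (M + 1) × ℕ) => W p.1 p.2 o)
      (fun o (p : Fin (M + 1) × ℕ) => (Xs p.1 p.2 o, Ys p.1 p.2 o)) P)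

/-! ### Effective dimension and entropy integral -/

/-- `h`, defined by `h⁻¹ = ∑_ν (1 + λ ρ_ν)⁻¹` (so that `h = 0` when the series diverges). -/
def effDim (ρ : ℕ → ℝ) (lam : ℝ) : ℝ := (∑' ν, (1 + lam * ρ ν)⁻¹)⁻¹

/-- `ψ₂(x) = exp(x²) - 1`. -/
def psi2 (x : ℝ) : ℝ := Real.exp (x ^ 2) - 1

/-- The inverse of `ψ₂` on `[0, ∞]`, at extended natural numbers: `ψ₂⁻¹(y) = √(log(1 + y))`. -/
def psi2Inv (D : ℕ∞) : ℝ≥0∞ :=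
  if D = ⊤ then ⊤ else ENNReal.ofReal √(Real.log (1 + (D.toNat : ℝ)))

theorem psi2_sqrt_log {y : ℝ} (hy : 0 ≤ y) : psi2 √(Real.log (1 + y)) = y := by
  rw [psi2, Real.sq_sqrt (Real.log_nonneg (by linarith)), Real.exp_log (by linarith)]
  ring

/-- `F = {f ∈ H : ‖f‖ ≤ c₁⁻¹ h^{1/2}}`. -/
def scaledBall (H : Type*) [NormedAddCommGroup H] [InnerProductSpace ℝ H]
    [RKHS ℝ H X ℝ] (μ : Fin (M + 1) → Measure X) (n : Fin (M + 1) → ℕ)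
    (ρ : ℕ → ℝ) (c₁ lam : ℝ) : Set H :=
  {f : H | pooledNorm μ n lam f ≤ c₁⁻¹ * √(effDim ρ lam)}

/-- The `ε`-covering number of a set of functions in `H` for the supremum norm
(`X →ᵤ ℝ` carries the distance `sup_x |f x - g x|`). -/
def supCoveringNumber (F : Set H) (ε : ℝ≥0) : ℕ∞ :=
  Metric.coveringNumber ε ((fun f : H => (UniformFun.ofFun (f : X → ℝ))) '' F)

/-- `a_λ = ∫₀¹ ψ₂⁻¹(D(F, ε, ‖·‖_∞)) dε ∈ [0, ∞]`. -/
def entropyIntegral (H : Type*) [NormedAddCommGroup H] [InnerProductSpace ℝ H]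
    [RKHS ℝ H X ℝ] (μ : Fin (M + 1) → Measure X) (n : Fin (M + 1) → ℕ)
    (ρ : ℕ → ℝ) (c₁ lam : ℝ) : ℝ≥0∞ :=
  ∫⁻ ε in Set.Ioc (0 : ℝ) 1,
    psi2Inv (supCoveringNumber (scaledBall H μ n ρ c₁ lam) ε.toNNReal)

/-! ### Estimator and score (for given realizations `x`, `y`, `w` of the data and weights) -/

/-- Penalized weighted least squares criterion. -/
def loss (n : Fin (M + 1) → ℕ) (lam : ℝ) (w : Fin (M + 1) → ℕ → ℝ)
    (x : Fin (M + 1) → ℕ → X) (y : Fin (M + 1) → ℕ → ℝ) (f : H) : ℝ :=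
  (2 * (totalSize n : ℝ))⁻¹ *
      ∑ m, ∑ i ∈ Finset.range (n m), w m i * |y m i - f (x m i)| ^ 2
    + lam / 2 * ‖f‖ ^ 2

/-- The estimator: the minimizer of the criterion over `H`. -/
def estimator (H : Type*) [NormedAddCommGroup H] [InnerProductSpace ℝ H] [RKHS ℝ H X ℝ]
    (n : Fin (M + 1) → ℕ) (lam : ℝ) (w : Fin (M + 1) → ℕ → ℝ)
    (x : Fin (M + 1) → ℕ → X) (y : Fin (M + 1) → ℕ → ℝ) : H :=
  Classical.epsilon fun f : H => ∀ g : H, loss n lam w x y f ≤ loss n lam w x y g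

/-- The score at `f`:
`-n⁻¹ ∑ₘ ∑ᵢ w m i * e m i • K_{x m i} + 𝒫_λ f` with `e m i = y m i - f (x m i)`. -/
def score (μ : Fin (M + 1) → Measure X) (n : Fin (M + 1) → ℕ) (lam : ℝ)
    (w : Fin (M + 1) → ℕ → ℝ) (x : Fin (M + 1) → ℕ → X) (y : Fin (M + 1) → ℕ → ℝ) (f : H) : H :=
  -((totalSize n : ℝ)⁻¹ • ∑ m, ∑ i ∈ Finset.range (n m),
      (w m i * (y m i - f (x m i))) • pooledKernel μ n lam (x m i))
    + penaltyOp μ n lam f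

end Forms

/-- `Z k = O_P(r k)` as `k → ∞`. -/
def IsBigOInProb {Ω : Type*} [MeasurableSpace Ω] (P : Measure Ω)
    (Z : ℕ → Ω → ℝ) (r : ℕ → ℝ) : Prop :=
  ∀ ε : ℝ, 0 < ε → ∃ C : ℝ, 0 < C ∧
    ∀ᶠ k in atTop, P {o | C * r k < |Z k o|} ≤ ENNReal.ofReal ε

end

end PooledKRR

open PooledKRR

/-!
The penalized criterion is quadratic, so the estimator `f̂` solves linear normal equations, and these
say exactly that `f̂ - f⋆ + S(f⋆)` represents `-Q(f̂ - f⋆, ·)` in the pooled inner product, where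
`Q(f, g) = n⁻¹ ∑ₘ ∑ᵢ ω f(X) g(X) - V(f, g)` is the deviation of the empirical quadratic form from its
mean (`pooledNorm_linearization_le`). Everything reduces to two stochastic bounds.

*Deviation of the form.* By polarization it is enough to bound `Q(f, f)`, a real-valued process. On
the ball `F` the functions are bounded by a constant (`sq_apply_le_mul_pooledInner`: the sup norm is at
most a multiple of `h^{-1/2}` times the pooled norm), so Hoeffding's inequality and the factorization
`f² - g² = (f - g)(f + g)` make the increments sub-Gaussian in the sup distance. Chaining along dyadic
nets (`measure_exists_increment_gt_le`) bounds `sup_F |Q(f, f)|` by a multiple of `a_λ / √n`, and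
rescaling gives `|Q(f, f)| ≤ C a_λ / √(n h²) ‖f‖²` for all `f`
(`measure_exists_form_deviation_gt_le`). The suprema are handled through union bounds over finite nets,
so their measurability plays no role. Different populations need not be independent of each other;
they are treated separately and added up.

*Size of the score.* The noise part of `S(f⋆)` is measured by its dual norm, which in the
diagonalizing basis is at most `b ∑_ν (1 + λ ρ_ν)⁻¹ A_ν²` with `A_ν` the weighted average of
`e φ_ν(X)`; each `A_ν` has second moment `O(1 / n)`, so Markov's inequality gives `O_P(1 / (n h))`
(`measure_noise_gt_le`). The penalty part contributes at most `λ ‖f⋆‖²`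
(`pooledInner_score_self_le`).

Since `a_λ / √(n h²) → 0`, the linearization error is eventually at most half of `‖f̂ - f⋆‖`, so
`‖f̂ - f⋆‖ ≤ 2 ‖S(f⋆)‖` with high probability. This is the first rate, and inserting it in
`‖f̂ - f⋆ + S(f⋆)‖ ≤ C a_λ / √(n h²) ‖f̂ - f⋆‖` gives the second.
-/

namespace PooledKRR

/-! ### Chaining with the entropy integral -/

theorem monotone_psi2Inv : Monotone psi2Inv := by
  intro D E hDE
  unfold psi2Inv
  by_cases hE : E = ⊤
  · simp [hE]
  · have hD : D ≠ ⊤ := ne_top_of_le_ne_top hE hDE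
    rw [if_neg hD, if_neg hE]
    have : D.toNat ≤ E.toNat := ENat.toNat_le_toNat hDE hE
    have : (D.toNat : ℝ) ≤ E.toNat := by exact_mod_cast this
    gcongr

/-- Lower Riemann sums over the dyadic partition of `(0, 1]`. -/
theorem sum_dyadic_le_lintegral {g : ℝ → ℝ≥0∞} (hg : Antitone g) (K : ℕ) :
    ∑ k ∈ Finset.range K, ENNReal.ofReal ((1 / 2) ^ (k + 1)) * g ((1 / 2) ^ k)
      ≤ ∫⁻ x in Set.Ioc ((1 / 2 : ℝ) ^ K) 1, g x := by
  induction K with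
  | zero => simp
  | succ K ih =>
    have h1 : (1 / 2 : ℝ) ^ (K + 1) ≤ (1 / 2) ^ K :=
      pow_le_pow_of_le_one (by norm_num) (by norm_num) (Nat.le_succ K)
    have h2 : (1 / 2 : ℝ) ^ K ≤ 1 := pow_le_one₀ (by norm_num) (by norm_num)
    rw [Finset.sum_range_succ, ← Set.Ioc_union_Ioc_eq_Ioc h1 h2,
      lintegral_union measurableSet_Ioc (Set.Ioc_disjoint_Ioc_of_le le_rfl), add_comm]
    gcongr
    calc ENNReal.ofReal ((1 / 2) ^ (K + 1)) * g ((1 / 2) ^ K)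
        = ∫⁻ _ in Set.Ioc ((1 / 2 : ℝ) ^ (K + 1)) ((1 / 2) ^ K), g ((1 / 2) ^ K) := by
          rw [setLIntegral_const, Real.volume_Ioc, mul_comm]
          congr 2
          ring
      _ ≤ _ := setLIntegral_mono' measurableSet_Ioc fun x hx => hg hx.2

theorem antitone_psi2Inv_coveringNumber {T : Type*} [PseudoEMetricSpace T] (A : Set T) :
    Antitone fun ε : ℝ => psi2Inv (Metric.coveringNumber ε.toNNReal A) := fun _ _ h =>
  monotone_psi2Inv (Metric.coveringNumber_anti (Real.toNNReal_le_toNNReal h))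

/-- A finite entropy integral makes the covering number finite at every dyadic radius. -/
theorem coveringNumber_ne_top {T : Type*} [PseudoEMetricSpace T] {A : Set T}
    (ha : ∫⁻ ε in Set.Ioc (0 : ℝ) 1, psi2Inv (Metric.coveringNumber ε.toNNReal A) ≠ ⊤) (k : ℕ) :
    Metric.coveringNumber ((1 / 2 : ℝ) ^ k).toNNReal A ≠ ⊤ := by
  intro htop
  apply ha
  have h := sum_dyadic_le_lintegral (antitone_psi2Inv_coveringNumber A) (k + 1)
  have h2 := h.trans (lintegral_mono_set (Set.Ioc_subset_Ioc_left (by positivity :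
    (0 : ℝ) ≤ (1 / 2) ^ (k + 1))))
  rw [Finset.sum_range_succ] at h2
  refine top_le_iff.1 (le_trans ?_ (le_trans le_add_self h2))
  simp only [htop, psi2Inv, if_true]
  rw [ENNReal.mul_top]
  simp

theorem sum_dyadic_entropy_le {T : Type*} [PseudoEMetricSpace T] {A : Set T}
    (ha : ∫⁻ ε in Set.Ioc (0 : ℝ) 1, psi2Inv (Metric.coveringNumber ε.toNNReal A) ≠ ⊤) (K : ℕ) :
    ∑ k ∈ Finset.range K, (1 / 2 : ℝ) ^ k *
        √(Real.log (1 + (Metric.coveringNumber ((1 / 2 : ℝ) ^ k).toNNReal A).toNat))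
      ≤ 2 * (∫⁻ ε in Set.Ioc (0 : ℝ) 1,
          psi2Inv (Metric.coveringNumber ε.toNNReal A)).toReal := by
  have h := sum_dyadic_le_lintegral (antitone_psi2Inv_coveringNumber A) K
  have h2 := h.trans (lintegral_mono_set (Set.Ioc_subset_Ioc_left (by positivity :
    (0 : ℝ) ≤ (1 / 2) ^ K)))
  have h3 := ENNReal.toReal_mono ha h2
  rw [ENNReal.toReal_sum] at h3
  · have : ∀ k, (1 / 2 : ℝ) ^ k *
        √(Real.log (1 + (Metric.coveringNumber ((1 / 2 : ℝ) ^ k).toNNReal A).toNat))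
        = 2 * (ENNReal.ofReal ((1 / 2) ^ (k + 1)) *
          psi2Inv (Metric.coveringNumber ((1 / 2 : ℝ) ^ k).toNNReal A)).toReal := by
      intro k
      rw [psi2Inv, if_neg (coveringNumber_ne_top ha k), ENNReal.toReal_mul,
        ENNReal.toReal_ofReal (by positivity), ENNReal.toReal_ofReal (by positivity)]
      ring
    simp_rw [this, ← Finset.mul_sum]
    linarith
  · intro k _
    rw [psi2Inv, if_neg (coveringNumber_ne_top ha k)]
    exact ENNReal.mul_ne_top ENNReal.ofReal_ne_top ENNReal.ofReal_ne_top

/-- Since a covering number of a nonempty set is at least one, the entropy integral is bounded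
below; this absorbs the entropy-free terms of the chaining bound. -/
theorem ofReal_half_le_lintegral_psi2Inv {T : Type*} [PseudoEMetricSpace T] {A : Set T}
    (hA : A.Nonempty) :
    ENNReal.ofReal (1 / 2) ≤ ∫⁻ ε in Set.Ioc (0 : ℝ) 1,
      psi2Inv (Metric.coveringNumber ε.toNNReal A) := by
  calc ENNReal.ofReal (1 / 2) = ∫⁻ _ in Set.Ioc (0 : ℝ) 1, ENNReal.ofReal (1 / 2) := by simp
    _ ≤ _ := by
      refine lintegral_mono fun ε => ?_
      dsimp only
      have h1 : (1 : ℕ∞) ≤ Metric.coveringNumber ε.toNNReal A :=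
        Order.one_le_iff_pos.2 (Metric.coveringNumber_pos_iff.2 hA)
      refine le_trans ?_ (monotone_psi2Inv h1)
      rw [psi2Inv, if_neg (by simp)]
      apply ENNReal.ofReal_le_ofReal
      apply Real.le_sqrt_of_sq_le
      have := Real.log_two_gt_d9
      norm_num
      linarith

/-- A finite covering number is attained by a finite net inside the set. -/
theorem exists_finset_cover {T : Type*} [PseudoEMetricSpace T] {A : Set T} {ε : ℝ≥0}
    (h : Metric.coveringNumber ε A ≠ ⊤) :
    ∃ S : Finset T, (S : Set T) ⊆ A ∧ (∀ t ∈ A, ∃ s ∈ S, edist t s ≤ ε) ∧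
      S.card = (Metric.coveringNumber ε A).toNat := by
  refine ⟨(Metric.finite_minimalCover (ε := ε) (A := A)).toFinset, ?_, ?_, ?_⟩
  · simpa using Metric.minimalCover_subset
  · intro t ht
    obtain ⟨s, hs, hts⟩ := Metric.isCover_minimalCover h ht
    exact ⟨s, by simpa using hs, hts⟩
  · rw [← Metric.encard_minimalCover h,
      ← Set.ncard_eq_toFinset_card _ Metric.finite_minimalCover, Set.ncard]

/-- **Dudley's chaining bound**, as a tail estimate: a process with sub-Gaussian increments
is, off an event of probability `δ`, bounded on the whole index set by a multiple of the entropy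
integral. No measurability of the supremum is needed. -/
theorem measure_exists_increment_gt_le {Ω T : Type*} [MeasurableSpace Ω] {P : Measure Ω}
    [PseudoEMetricSpace T] {A : Set T} {Z : T → Ω → ℝ} {t₀ : T} (ht₀ : t₀ ∈ A) {R σ δ L : ℝ}
    (hR : 0 ≤ R) (hσ : 0 < σ) (hAR : ∀ t ∈ A, edist t t₀ ≤ ENNReal.ofReal R)
    (hinc : ∀ s ∈ A, ∀ t ∈ A, ∀ r > 0, edist s t ≤ ENNReal.ofReal r → ∀ u > 0,
      P {ω | σ * r * u < |Z s ω - Z t ω|} ≤ ENNReal.ofReal (2 * Real.exp (-u ^ 2)))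
    (hlip : ∀ᵐ ω ∂P, ∃ C, ∀ s ∈ A, ∀ t ∈ A, ∀ r > 0, edist s t ≤ ENNReal.ofReal r →
      |Z s ω - Z t ω| ≤ C * r)
    (hL0 : 0 < L) (hL : 2 ≤ L ^ 2) (hδ : 0 < δ) (hδ1 : δ ≤ 1)
    (hLδ : Real.exp (-L ^ 2) ≤ δ / 4)
    (ha : ∫⁻ ε in Set.Ioc (0 : ℝ) 1, psi2Inv (Metric.coveringNumber ε.toNNReal A) ≠ ⊤) :
    P {ω | ∃ t ∈ A, 10 * (R + 3) * L * σ * (∫⁻ ε in Set.Ioc (0 : ℝ) 1,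
        psi2Inv (Metric.coveringNumber ε.toNNReal A)).toReal < |Z t ω - Z t₀ ω|}
      ≤ ENNReal.ofReal δ := by
  classical
  set a := (∫⁻ ε in Set.Ioc (0 : ℝ) 1, psi2Inv (Metric.coveringNumber ε.toNNReal A)).toReal
    with ha_def
  set N : ℕ → ℕ := fun k => (Metric.coveringNumber ((1 / 2 : ℝ) ^ k).toNNReal A).toNat with hN
  have hpow : ∀ k : ℕ, (0 : ℝ) < (1 / 2) ^ k := fun k => by positivity
  choose S' hS'A hS'cov hS'card using fun k => exists_finset_cover (coveringNumber_ne_top ha k)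
  -- nets: the single point `t₀`, then minimal `2⁻ᵏ`-covers
  let S : ℕ → Finset T := fun k => Nat.casesOn k {t₀} S'
  have hSA : ∀ k, ∀ s ∈ S k, s ∈ A := by
    intro k s hs
    cases k with
    | zero => simpa [S, Finset.mem_singleton.1 hs] using ht₀
    | succ k => exact hS'A k hs
  have hN1 : ∀ k, 1 ≤ N k := by
    intro k
    rw [hN]
    dsimp only
    rw [← hS'card k, Nat.one_le_iff_ne_zero, Finset.card_ne_zero]
    obtain ⟨s, hs, -⟩ := hS'cov k t₀ ht₀
    exact ⟨s, hs⟩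
  have hcard1 : ∀ k, (S (k + 1)).card ≤ N k := fun k => (hS'card k).le
  have hcard0 : ∀ k, (S k).card ≤ N k := by
    intro k
    cases k with
    | zero => simpa [S] using hN1 0
    | succ k =>
      refine (hcard1 k).trans (ENat.toNat_le_toNat (Metric.coveringNumber_anti ?_)
        (coveringNumber_ne_top ha _))
      exact Real.toNNReal_le_toNNReal
        (pow_le_pow_of_le_one (by norm_num) (by norm_num) (Nat.le_succ k))
  let rad : ℕ → ℝ := fun k => Nat.casesOn k R fun k => (1 / 2) ^ k
  have hrad0 : ∀ k, 0 ≤ rad k := by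
    intro k
    cases k with
    | zero => exact hR
    | succ k => exact (hpow k).le
  have hcov : ∀ k, ∀ t ∈ A, ∃ s ∈ S k, edist t s ≤ ENNReal.ofReal (rad k) := by
    intro k t ht
    cases k with
    | zero => exact ⟨t₀, Finset.mem_singleton_self _, hAR t ht⟩
    | succ k => exact hS'cov k t ht
  -- `2⁻ᵏ + 2⁻ᵏ⁻¹ ≤ 3 · 2⁻ᵏ` between consecutive covers, and `R` plus the first radius at level `0`
  let r : ℕ → ℝ := fun k => (R + 3) * (1 / 2) ^ k
  have hr0 : ∀ k, 0 < r k := fun k => mul_pos (by linarith) (hpow k)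
  have hrad : ∀ k, rad k + rad (k + 1) ≤ r k := by
    intro k
    cases k with
    | zero => simp [rad, r]
    | succ k =>
      have h1 := mul_nonneg hR (hpow (k + 1)).le
      have h2 : (1 / 2 : ℝ) ^ (k + 1) = (1 / 2) ^ k / 2 := by ring
      simp only [rad, r, add_mul]
      linarith
  let g : ℕ → ℝ := fun k => √(Real.log (1 + N k))
  -- the entropy part of `u k` beats the number of pairs, the part `k + 1` makes the tails summable
  let u : ℕ → ℝ := fun k => L * (g k + (k + 1))
  have hg0 : ∀ k, 0 ≤ g k := fun k => Real.sqrt_nonneg _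
  have hu0 : ∀ k, 0 < u k := fun k => mul_pos hL0 (by have := hg0 k; positivity)
  -- failure of the increment bound on some link between the nets of levels `k` and `k + 1`
  let B : ℕ → Set Ω := fun k => ⋃ s ∈ S (k + 1), ⋃ t ∈ S k,
    {ω | edist s t ≤ ENNReal.ofReal (r k) ∧ σ * r k * u k < |Z s ω - Z t ω|}
  have hB : ∀ k, P (B k) ≤ ENNReal.ofReal (δ * (1 / 2) ^ (k + 1)) := by
    intro k
    have h1 : P (B k) ≤ ∑ s ∈ S (k + 1), ∑ t ∈ S k, ENNReal.ofReal (2 * Real.exp (-u k ^ 2)) := by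
      refine (measure_biUnion_finset_le _ _).trans (Finset.sum_le_sum fun s hs => ?_)
      refine (measure_biUnion_finset_le _ _).trans (Finset.sum_le_sum fun t ht => ?_)
      by_cases hst : edist s t ≤ ENNReal.ofReal (r k)
      · simpa [hst] using hinc s (hSA (k + 1) s hs) t (hSA k t ht) (r k) (hr0 k) hst (u k) (hu0 k)
      · simp [hst]
    refine h1.trans ?_
    rw [Finset.sum_const, Finset.sum_const, smul_smul, nsmul_eq_mul,
      ← ENNReal.ofReal_natCast, ← ENNReal.ofReal_mul (by positivity)]
    apply ENNReal.ofReal_le_ofReal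
    have hc : (((S (k + 1)).card * (S k).card : ℕ) : ℝ) ≤ (1 + N k) ^ 2 := by
      have h3 : (((S (k + 1)).card * (S k).card : ℕ) : ℝ) ≤ ((N k * N k : ℕ) : ℝ) := by
        exact_mod_cast Nat.mul_le_mul (hcard1 k) (hcard0 k)
      refine h3.trans ?_
      push_cast
      nlinarith [(Nat.cast_nonneg (N k) : (0 : ℝ) ≤ N k)]
    have hexp : Real.exp (-u k ^ 2) ≤ ((1 + N k : ℝ) ^ 2)⁻¹ * (Real.exp (-L ^ 2)) ^ (k + 1) := by
      have h1N : (0 : ℝ) < 1 + N k := by positivity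
      have : ((1 + N k : ℝ) ^ 2)⁻¹ = Real.exp (-(2 * Real.log (1 + N k))) := by
        rw [Real.exp_neg, two_mul, Real.exp_add, Real.exp_log h1N, sq]
      rw [this, ← Real.exp_nat_mul, ← Real.exp_add]
      apply Real.exp_le_exp.2
      have hgsq : g k ^ 2 = Real.log (1 + N k) :=
        Real.sq_sqrt (Real.log_nonneg (by linarith [(Nat.cast_nonneg (N k) : (0 : ℝ) ≤ N k)]))
      rw [← hgsq]
      simp only [u]
      push_cast
      have hk : (0 : ℝ) ≤ k := Nat.cast_nonneg k
      have e1 : (g k + (k + 1)) ^ 2 ≥ g k ^ 2 + (k + 1) := by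
        nlinarith [mul_nonneg (hg0 k) hk, hg0 k]
      have e2 : L ^ 2 * (g k + (k + 1)) ^ 2 ≥ L ^ 2 * (g k ^ 2 + (k + 1)) := by gcongr
      have e3 : L ^ 2 * g k ^ 2 ≥ 2 * g k ^ 2 := by gcongr
      nlinarith
    calc (((S (k + 1)).card * (S k).card : ℕ) : ℝ) * (2 * Real.exp (-u k ^ 2))
        ≤ (1 + N k) ^ 2 * (2 * (((1 + N k : ℝ) ^ 2)⁻¹ * (Real.exp (-L ^ 2)) ^ (k + 1))) := by
          gcongr
      _ = 2 * (Real.exp (-L ^ 2)) ^ (k + 1) := by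
          have : (0 : ℝ) < 1 + N k := by positivity
          field_simp
      _ ≤ 2 * (δ / 4) ^ (k + 1) := by gcongr
      _ = (2 * (1 / 2) ^ (k + 1)) * (δ * δ ^ k) * (1 / 2) ^ (k + 1) := by
          rw [div_pow, pow_succ δ, show (4 : ℝ) = 2 * 2 by norm_num, mul_pow]
          simp only [one_div, inv_pow]
          field_simp
      _ ≤ 1 * (δ * 1) * (1 / 2) ^ (k + 1) := by
          have := pow_le_one₀ (n := k) (by norm_num : (0 : ℝ) ≤ 1 / 2) (by norm_num)
          have := pow_le_one₀ (n := k) hδ.le hδ1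
          gcongr
          rw [pow_succ]
          linarith
      _ = δ * (1 / 2) ^ (k + 1) := by ring
  have hBtot : P (⋃ k, B k) ≤ ENNReal.ofReal δ := by
    refine (measure_iUnion_le _).trans ((ENNReal.tsum_le_tsum hB).trans ?_)
    have hs : HasSum (fun k : ℕ => δ * (1 / 2 : ℝ) ^ (k + 1)) δ := by
      refine (hasSum_geometric_two' δ).congr_fun fun k => ?_
      rw [pow_succ]
      simp only [one_div, inv_pow]
      field_simp
    rw [← ENNReal.ofReal_tsum_of_nonneg (fun k => by positivity) hs.summable, hs.tsum_eq]
  refine (measure_mono_ae ?_).trans hBtot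
  filter_upwards [hlip] with ω hω
  rintro ⟨t, ht, hgt⟩
  by_contra hnot
  change ω ∉ ⋃ k, B k at hnot
  simp only [B, Set.mem_iUnion, Set.mem_ofPred_eq, not_exists, not_and, not_lt] at hnot
  obtain ⟨C, hC⟩ := hω
  choose p hpS hpd using fun k => hcov k t ht
  have hp0 : p 0 = t₀ := Finset.mem_singleton.1 (hpS 0)
  have hstep : ∀ k, |Z (p (k + 1)) ω - Z (p k) ω| ≤ σ * r k * u k := by
    intro k
    refine hnot k _ (hpS (k + 1)) _ (hpS k) ?_
    refine (edist_triangle_left _ _ t).trans ?_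
    refine (add_le_add (hpd (k + 1)) (hpd k)).trans ?_
    rw [← ENNReal.ofReal_add (hrad0 (k + 1)) (hrad0 k)]
    exact ENNReal.ofReal_le_ofReal (by linarith [hrad k])
  have ha2 : 1 / 2 ≤ a := (ENNReal.ofReal_le_iff_le_toReal ha).1
    (ofReal_half_le_lintegral_psi2Inv ⟨t₀, ht₀⟩)
  have hsum : ∀ K, ∑ k ∈ Finset.range K, σ * r k * u k ≤ 10 * (R + 3) * L * σ * a := by
    intro K
    have h1 : ∑ k ∈ Finset.range K, (1 / 2 : ℝ) ^ k * g k ≤ 2 * a := sum_dyadic_entropy_le ha K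
    have h2 : ∀ K : ℕ, ∑ k ∈ Finset.range K, (1 / 2 : ℝ) ^ k * (k + 1)
        ≤ 4 - (2 * K + 4) * (1 / 2) ^ K := by
      intro K
      induction K with
      | zero => simp
      | succ K ih =>
        rw [Finset.sum_range_succ]
        push_cast
        rw [pow_succ]
        nlinarith [hpow K]
    have h3 : ∑ k ∈ Finset.range K, (1 / 2 : ℝ) ^ k * (k + 1) ≤ 4 := by
      have := h2 K
      have := mul_nonneg (by positivity : (0 : ℝ) ≤ 2 * K + 4) (hpow K).le
      linarith
    have h4 : ∑ k ∈ Finset.range K, σ * r k * u k = (R + 3) * L * σ *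
        (∑ k ∈ Finset.range K, (1 / 2 : ℝ) ^ k * g k
          + ∑ k ∈ Finset.range K, (1 / 2 : ℝ) ^ k * (k + 1)) := by
      rw [← Finset.sum_add_distrib, Finset.mul_sum]
      refine Finset.sum_congr rfl fun k _ => ?_
      simp only [r, u]
      ring
    rw [h4]
    have : (R + 3) * L * σ * (∑ k ∈ Finset.range K, (1 / 2 : ℝ) ^ k * g k
          + ∑ k ∈ Finset.range K, (1 / 2 : ℝ) ^ k * (k + 1))
        ≤ (R + 3) * L * σ * (10 * a) := by
      gcongr
      linarith
    linarith
  have hK : ∀ K : ℕ, |Z t ω - Z t₀ ω| ≤ C * (1 / 2) ^ K + 10 * (R + 3) * L * σ * a := by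
    intro K
    have h1 : |Z t ω - Z (p (K + 1)) ω| ≤ C * (1 / 2) ^ K :=
      hC t ht _ (hSA (K + 1) _ (hpS (K + 1))) _ (hpow K) (hpd (K + 1))
    have h2 : |Z (p (K + 1)) ω - Z t₀ ω| ≤ ∑ k ∈ Finset.range (K + 1), σ * r k * u k := by
      rw [← hp0, ← Finset.sum_range_sub (fun k => Z (p k) ω)]
      exact (Finset.abs_sum_le_sum_abs _ _).trans (Finset.sum_le_sum fun k _ => hstep k)
    have := abs_sub_le (Z t ω) (Z (p (K + 1)) ω) (Z t₀ ω)
    linarith [hsum (K + 1)]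
  -- the remainder of the chain vanishes by the sample-path Lipschitz bound
  have hlim : Tendsto (fun K : ℕ => C * (1 / 2 : ℝ) ^ K + 10 * (R + 3) * L * σ * a) atTop
      (𝓝 (C * 0 + 10 * (R + 3) * L * σ * a)) :=
    ((tendsto_pow_atTop_nhds_zero_of_lt_one (by norm_num) (by norm_num)).const_mul C).add_const _
  have := ge_of_tendsto' hlim hK
  linarith

/-! ### Representers and diagonalized quadratic forms -/

section Hilbert

variable {X H : Type*} [NormedAddCommGroup H] [InnerProductSpace ℝ H]

/-- **Lax–Milgram** for a bilinear form given with explicit bounds. -/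
theorem exists_representer [CompleteSpace H] (B : H →ₗ[ℝ] H →ₗ[ℝ] ℝ) {C c : ℝ}
    (hC : ∀ f g, |B f g| ≤ C * ‖f‖ * ‖g‖) (hc : 0 < c) (hpos : ∀ f, c * ‖f‖ ^ 2 ≤ B f f)
    (l : H →L[ℝ] ℝ) : ∃ f, ∀ g, B f g = l g := by
  let B' : H →L[ℝ] H →L[ℝ] ℝ := B.mkContinuous₂ C hC
  have hB' : IsCoercive B' := ⟨c, hc, fun f => by
    have := hpos f
    simp only [B', LinearMap.mkContinuous₂_apply]
    nlinarith⟩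
  refine ⟨hB'.continuousLinearEquivOfBilin.symm ((InnerProductSpace.toDual ℝ H).symm l),
    fun g => ?_⟩
  have h := hB'.continuousLinearEquivOfBilin_apply
    (hB'.continuousLinearEquivOfBilin.symm ((InnerProductSpace.toDual ℝ H).symm l)) g
  rw [ContinuousLinearEquiv.apply_symm_apply, InnerProductSpace.toDual_symm_apply] at h
  exact h.symm

/-- A functional is controlled by a quadratic form `B` that a total family diagonalizes: the
Cauchy–Schwarz inequality on the span of the family, extended by density. -/
theorem sq_le_of_diagonalizes (B : H →ₗ[ℝ] H →ₗ[ℝ] ℝ) (hB : Continuous fun f => B f f)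
    {φ : ℕ → H} (hφ : (Submodule.span ℝ (Set.range φ)).topologicalClosure = ⊤) {d : ℕ → ℝ}
    (hd : ∀ ν, 0 < d ν) (hdiag : ∀ ν ν', B (φ ν) (φ ν') = if ν = ν' then d ν else 0)
    (l : H →L[ℝ] ℝ) {C : ℝ} (hC : ∀ s : Finset ℕ, ∑ ν ∈ s, l (φ ν) ^ 2 / d ν ≤ C) (f : H) :
    l f ^ 2 ≤ C * B f f := by
  have hdense : Dense (Submodule.span ℝ (Set.range φ) : Set H) :=
    Submodule.dense_iff_topologicalClosure_eq_top.2 hφ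
  refine hdense.induction (P := fun f => l f ^ 2 ≤ C * B f f) ?_
    (isClosed_le (by fun_prop) (continuous_const.mul hB)) f
  intro f hf
  obtain ⟨c, rfl⟩ := Finsupp.mem_span_range_iff_exists_finsupp.1 hf
  have h1 : B (c.sum fun i a => a • φ i) (c.sum fun i a => a • φ i)
      = ∑ ν ∈ c.support, c ν ^ 2 * d ν := by
    simp only [Finsupp.sum, map_sum, LinearMap.sum_apply, map_smul, LinearMap.smul_apply,
      hdiag, smul_eq_mul]
    refine Finset.sum_congr rfl fun ν hν => ?_
    rw [Finset.sum_eq_single ν]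
    · rw [if_pos rfl]
      ring
    · intro ν' _ hne
      simp [hne]
    · exact fun h => absurd hν h
  have h2 : l (c.sum fun i a => a • φ i) = ∑ ν ∈ c.support, c ν * l (φ ν) := by
    simp [Finsupp.sum]
  rw [h1, h2]
  calc (∑ ν ∈ c.support, c ν * l (φ ν)) ^ 2
      ≤ (∑ ν ∈ c.support, l (φ ν) ^ 2 / d ν) * ∑ ν ∈ c.support, c ν ^ 2 * d ν := by
        refine Finset.sum_sq_le_sum_mul_sum_of_sq_le_mul _ (fun ν _ => ?_) (fun ν _ => ?_)
          (fun ν _ => le_of_eq ?_)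
        · have := hd ν; positivity
        · have := hd ν; positivity
        · have := (hd ν).ne'; field_simp
    _ ≤ _ := by
        gcongr
        · exact Finset.sum_nonneg fun ν _ => by have := hd ν; positivity
        · exact hC _

variable [RKHS ℝ H X ℝ]

/-- Evaluation at a point, as a continuous linear functional. -/
noncomputable def evalCLM (H : Type*) [NormedAddCommGroup H] [InnerProductSpace ℝ H]
    [RKHS ℝ H X ℝ] (x : X) : H →L[ℝ] ℝ :=
  (ContinuousLinearMap.proj x).comp (RKHS.coeCLM ℝ)

@[simp] theorem evalCLM_apply (x : X) (f : H) : evalCLM H x f = f x := rfl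

/-- If `∑ 1 / ρ_ν` converges, the functions in `H` are bounded and the sup norm is dominated by the
norm of `H`. -/
theorem exists_abs_le_mul_norm {φ : ℕ → H} {ρ : ℕ → ℝ} (hρ : ∀ ν, 0 < ρ ν)
    (hφ : (Submodule.span ℝ (Set.range φ)).topologicalClosure = ⊤)
    (hin : ∀ ν ν', inner ℝ (φ ν) (φ ν') = if ν = ν' then ρ ν else 0)
    (hbd : ∃ B : ℝ, ∀ ν x, |φ ν x| ≤ B) (hs : Summable fun ν => (ρ ν)⁻¹) :
    ∃ K : ℝ, 0 ≤ K ∧ ∀ (f : H) x, |f x| ≤ K * ‖f‖ := by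
  obtain ⟨B, hB⟩ := hbd
  refine ⟨√(B ^ 2 * ∑' ν, (ρ ν)⁻¹), Real.sqrt_nonneg _, fun f x => ?_⟩
  have h := sq_le_of_diagonalizes (innerₗ H) (by simp; fun_prop) hφ hρ
    (by simpa using hin) (evalCLM H x) (C := B ^ 2 * ∑' ν, (ρ ν)⁻¹) (fun s => ?_) f
  · simp only [evalCLM_apply, innerₗ_apply_apply, real_inner_self_eq_norm_sq] at h
    rw [← Real.sqrt_sq (norm_nonneg f), ← Real.sqrt_mul' _ (sq_nonneg _)]
    exact Real.abs_le_sqrt h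
  · refine le_trans ?_ (mul_le_mul_of_nonneg_left
      (hs.sum_le_tsum s fun ν _ => (inv_pos.2 (hρ ν)).le) (sq_nonneg B))
    rw [Finset.mul_sum]
    refine Finset.sum_le_sum fun ν _ => ?_
    rw [div_eq_mul_inv]
    exact mul_le_mul_of_nonneg_right (sq_le_sq' (abs_le.1 (hB ν x)).1 (abs_le.1 (hB ν x)).2)
      (inv_pos.2 (hρ ν)).le

/-- Convergence of the series defining `h` for one `λ` gives `∑ 1 / ρ_ν < ∞`, hence boundedness of
every function in `H`; without it the forms `V_m` need not be finite on `H`. -/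
theorem summable_inv_of_summable {ρ : ℕ → ℝ} (hρ : ∀ ν, 0 < ρ ν) (hmono : Monotone ρ) {lam : ℝ}
    (hlam : 0 < lam) (hs : Summable fun ν => (1 + lam * ρ ν)⁻¹) : Summable fun ν => (ρ ν)⁻¹ := by
  refine Summable.of_nonneg_of_le (fun ν => (inv_pos.2 (hρ ν)).le) (fun ν => ?_)
    (hs.mul_left ((ρ 0)⁻¹ + lam))
  have h0 := hρ 0
  have h1 := hρ ν
  have h2 : ρ 0 ≤ ρ ν := hmono (Nat.zero_le ν)
  rw [← div_eq_mul_inv, inv_eq_one_div, div_le_div_iff₀ h1 (by positivity)]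
  have : 1 ≤ (ρ 0)⁻¹ * ρ ν := by
    rw [inv_mul_eq_div, one_le_div h0]
    exact h2
  linarith

end Hilbert

/-! ### Sample averages and the criterion -/

section Sample

variable {X H : Type*} [NormedAddCommGroup H] [InnerProductSpace ℝ H] [RKHS ℝ H X ℝ] {M : ℕ}

/-- The average `n⁻¹ ∑ₘ ∑ᵢ a m i` over the pooled sample. -/
noncomputable def pooledMean (n : Fin (M + 1) → ℕ) (a : Fin (M + 1) → ℕ → ℝ) : ℝ :=
  (totalSize n : ℝ)⁻¹ * ∑ m, ∑ i ∈ Finset.range (n m), a m i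

theorem pooledMean_add (n : Fin (M + 1) → ℕ) (a a' : Fin (M + 1) → ℕ → ℝ) :
    pooledMean n (fun m i => a m i + a' m i) = pooledMean n a + pooledMean n a' := by
  simp [pooledMean, Finset.sum_add_distrib, mul_add]

theorem pooledMean_const_mul (n : Fin (M + 1) → ℕ) (c : ℝ) (a : Fin (M + 1) → ℕ → ℝ) :
    pooledMean n (fun m i => c * a m i) = c * pooledMean n a := by
  simp only [pooledMean, ← Finset.mul_sum]
  ring

theorem pooledMean_nonneg (n : Fin (M + 1) → ℕ) {a : Fin (M + 1) → ℕ → ℝ}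
    (ha : ∀ m i, 0 ≤ a m i) : 0 ≤ pooledMean n a :=
  mul_nonneg (by positivity) (Finset.sum_nonneg fun m _ => Finset.sum_nonneg fun i _ => ha m i)

theorem abs_pooledMean_le (n : Fin (M + 1) → ℕ) {a a' : Fin (M + 1) → ℕ → ℝ}
    (ha : ∀ m i, |a m i| ≤ a' m i) : |pooledMean n a| ≤ pooledMean n a' := by
  rw [pooledMean, abs_mul, abs_of_nonneg (by positivity), pooledMean]
  gcongr
  refine (Finset.abs_sum_le_sum_abs _ _).trans (Finset.sum_le_sum fun m _ => ?_)
  exact (Finset.abs_sum_le_sum_abs _ _).trans (Finset.sum_le_sum fun i _ => ha m i)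

/-- The functional `g ↦ n⁻¹ ∑ₘ ∑ᵢ a m i * g (x m i)`. -/
noncomputable def sampleCLM (H : Type*) [NormedAddCommGroup H] [InnerProductSpace ℝ H]
    [RKHS ℝ H X ℝ] (n : Fin (M + 1) → ℕ) (a : Fin (M + 1) → ℕ → ℝ)
    (x : Fin (M + 1) → ℕ → X) : H →L[ℝ] ℝ :=
  (totalSize n : ℝ)⁻¹ • ∑ m, ∑ i ∈ Finset.range (n m), a m i • evalCLM H (x m i)

theorem sampleCLM_apply (n : Fin (M + 1) → ℕ) (a : Fin (M + 1) → ℕ → ℝ)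
    (x : Fin (M + 1) → ℕ → X) (g : H) :
    sampleCLM H n a x g = pooledMean n fun m i => a m i * g (x m i) := by
  simp [sampleCLM, pooledMean]

/-- The empirical quadratic form `n⁻¹ ∑ₘ ∑ᵢ w m i * f (x m i) * g (x m i)`. -/
noncomputable def sampleBilin (H : Type*) [NormedAddCommGroup H] [InnerProductSpace ℝ H]
    [RKHS ℝ H X ℝ] (n : Fin (M + 1) → ℕ) (w : Fin (M + 1) → ℕ → ℝ)
    (x : Fin (M + 1) → ℕ → X) : H →ₗ[ℝ] H →ₗ[ℝ] ℝ :=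
  (totalSize n : ℝ)⁻¹ • ∑ m, ∑ i ∈ Finset.range (n m),
    w m i • (LinearMap.mul ℝ ℝ).compl₁₂ (evalCLM H (x m i) : H →ₗ[ℝ] ℝ)
      (evalCLM H (x m i) : H →ₗ[ℝ] ℝ)

theorem sampleBilin_apply (n : Fin (M + 1) → ℕ) (w : Fin (M + 1) → ℕ → ℝ)
    (x : Fin (M + 1) → ℕ → X) (f g : H) :
    sampleBilin H n w x f g = pooledMean n fun m i => w m i * (f (x m i) * g (x m i)) := by
  simp [sampleBilin, pooledMean, LinearMap.sum_apply]

theorem loss_eq_pooledMean (n : Fin (M + 1) → ℕ) (lam : ℝ) (w : Fin (M + 1) → ℕ → ℝ)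
    (x : Fin (M + 1) → ℕ → X) (y : Fin (M + 1) → ℕ → ℝ) (f : H) :
    loss n lam w x y f =
      1 / 2 * pooledMean n (fun m i => w m i * (y m i - f (x m i)) ^ 2) + lam / 2 * ‖f‖ ^ 2 := by
  simp only [loss, pooledMean, sq_abs, mul_inv]
  ring

/-- At a solution `f` of the normal equations the criterion is an exact parabola. -/
theorem loss_eq_of_normal_equation (n : Fin (M + 1) → ℕ) {lam : ℝ} (w : Fin (M + 1) → ℕ → ℝ)
    (x : Fin (M + 1) → ℕ → X) (y : Fin (M + 1) → ℕ → ℝ) {f : H}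
    (hf : ∀ g, pooledMean n (fun m i => w m i * (y m i - f (x m i)) * g (x m i))
      = lam * inner ℝ f g) (g : H) :
    loss n lam w x y g = loss n lam w x y f +
      1 / 2 * pooledMean n (fun m i => w m i * (g - f : H) (x m i) ^ 2)
      + lam / 2 * ‖g - f‖ ^ 2 := by
  have h1 : pooledMean n (fun m i => w m i * (y m i - g (x m i)) ^ 2) =
      pooledMean n (fun m i => w m i * (y m i - f (x m i)) ^ 2)
      + (-2) * pooledMean n (fun m i => w m i * (y m i - f (x m i)) * (g - f : H) (x m i))
      + pooledMean n (fun m i => w m i * (g - f : H) (x m i) ^ 2) := by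
    rw [← pooledMean_const_mul, ← pooledMean_add, ← pooledMean_add]
    congr 1
    ext m i
    simp only [RKHS.coe_sub, Pi.sub_apply]
    ring
  have h2 : ‖g‖ ^ 2 = ‖f‖ ^ 2 + 2 * inner ℝ f (g - f) + ‖g - f‖ ^ 2 := by
    rw [← norm_add_sq_real, add_sub_cancel]
  rw [loss_eq_pooledMean, loss_eq_pooledMean, h1, hf, h2]
  ring

end Sample

/-! ### The pooled inner product, the score and the estimator -/

section Forms

variable {X H : Type*} [MeasurableSpace X] [NormedAddCommGroup H] [InnerProductSpace ℝ H]
  [RKHS ℝ H X ℝ] {M : ℕ}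

/-- Every function in `H` is measurable, and the sup norm is at most `K` times the norm of `H`. -/
structure BoundedEval (H : Type*) [NormedAddCommGroup H] [InnerProductSpace ℝ H]
    [RKHS ℝ H X ℝ] (K : ℝ) : Prop where
  measurable : ∀ f : H, Measurable (f : X → ℝ)
  nonneg : 0 ≤ K
  abs_le : ∀ (f : H) (x : X), |f x| ≤ K * ‖f‖

namespace BoundedEval

variable {K : ℝ} (hK : BoundedEval (X := X) H K)
include hK

theorem abs_mul_le (f g : H) (x : X) : |f x * g x| ≤ K ^ 2 * ‖f‖ * ‖g‖ := by
  rw [abs_mul]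
  calc |f x| * |g x| ≤ (K * ‖f‖) * (K * ‖g‖) :=
        mul_le_mul (hK.abs_le f x) (hK.abs_le g x) (abs_nonneg _)
          (mul_nonneg hK.nonneg (norm_nonneg _))
    _ = _ := by ring

theorem integrable_mul (μ : Measure X) [IsFiniteMeasure μ] (f g : H) :
    Integrable (fun x => f x * g x) μ :=
  Integrable.of_bound ((hK.measurable f).mul (hK.measurable g)).aestronglyMeasurable
    (K ^ 2 * ‖f‖ * ‖g‖) (ae_of_all _ fun x => hK.abs_mul_le f g x)

theorem abs_quadForm_le (μ : Measure X) [IsProbabilityMeasure μ] (f g : H) :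
    |quadForm μ f g| ≤ K ^ 2 * ‖f‖ * ‖g‖ := by
  have := norm_integral_le_of_norm_le_const (μ := μ) (f := fun x => f x * g x)
    (ae_of_all _ fun x => hK.abs_mul_le f g x)
  simpa [quadForm] using this

end BoundedEval

theorem quadForm_comm (μ : Measure X) (f g : H) : quadForm μ f g = quadForm μ g f := by
  simp only [quadForm, mul_comm]

theorem quadForm_self_nonneg (μ : Measure X) (f : H) : 0 ≤ quadForm μ f f :=
  integral_nonneg fun x => mul_self_nonneg (f x)

/-- `V_m` as a bilinear form. -/
noncomputable def quadBilin {K : ℝ} (hK : BoundedEval (X := X) H K) (μ : Measure X)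
    [IsFiniteMeasure μ] : H →ₗ[ℝ] H →ₗ[ℝ] ℝ :=
  LinearMap.mk₂ ℝ (quadForm μ)
    (fun f f' g => by
      simp only [quadForm, RKHS.coe_add, Pi.add_apply, add_mul]
      exact integral_add (hK.integrable_mul μ f g) (hK.integrable_mul μ f' g))
    (fun c f g => by
      simp only [quadForm, RKHS.coe_smul, Pi.smul_apply, smul_eq_mul, mul_assoc]
      exact integral_const_mul c _)
    (fun f g g' => by
      simp only [quadForm, RKHS.coe_add, Pi.add_apply, mul_add]
      exact integral_add (hK.integrable_mul μ f g) (hK.integrable_mul μ f g'))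
    (fun c f g => by
      simp only [quadForm, RKHS.coe_smul, Pi.smul_apply, smul_eq_mul, mul_left_comm _ c]
      exact integral_const_mul c _)

/-- The pooled inner product as a bilinear form. -/
noncomputable def pooledBilin {K : ℝ} (hK : BoundedEval (X := X) H K) (μ : Fin (M + 1) → Measure X)
    [∀ m, IsProbabilityMeasure (μ m)] (n : Fin (M + 1) → ℕ) (lam : ℝ) : H →ₗ[ℝ] H →ₗ[ℝ] ℝ :=
  (totalSize n : ℝ)⁻¹ • ∑ m, (n m : ℝ) • quadBilin hK (μ m) + lam • innerₗ H

theorem pooledInner_comm (μ : Fin (M + 1) → Measure X) (n : Fin (M + 1) → ℕ) {lam : ℝ}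
    (f g : H) : pooledInner μ n lam f g = pooledInner μ n lam g f := by
  simp only [pooledInner, pooledForm, quadForm_comm _ f g, real_inner_comm]

theorem lam_mul_sq_le_pooledInner (μ : Fin (M + 1) → Measure X) (n : Fin (M + 1) → ℕ) {lam : ℝ}
    (f : H) : lam * ‖f‖ ^ 2 ≤ pooledInner μ n lam f f := by
  rw [pooledInner, real_inner_self_eq_norm_sq]
  have : 0 ≤ pooledForm μ n f f := mul_nonneg (by positivity)
    (Finset.sum_nonneg fun m _ => mul_nonneg (by positivity) (quadForm_self_nonneg _ f))
  linarith

theorem pooledInner_self_nonneg (μ : Fin (M + 1) → Measure X) (n : Fin (M + 1) → ℕ) {lam : ℝ}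
    (hlam : 0 < lam) (f : H) : 0 ≤ pooledInner μ n lam f f :=
  le_trans (by positivity) (lam_mul_sq_le_pooledInner μ n f)

variable {K : ℝ} (hK : BoundedEval (X := X) H K) (μ : Fin (M + 1) → Measure X)
    [∀ m, IsProbabilityMeasure (μ m)] (n : Fin (M + 1) → ℕ) {lam : ℝ}

theorem pooledBilin_apply (f g : H) : pooledBilin hK μ n lam f g = pooledInner μ n lam f g := by
  simp [pooledBilin, pooledInner, pooledForm, quadBilin, LinearMap.sum_apply]

include hK in
theorem abs_pooledInner_le (hlam : 0 < lam) : ∃ C, ∀ f g : H,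
    |pooledInner μ n lam f g| ≤ C * ‖f‖ * ‖g‖ := by
  refine ⟨(totalSize n : ℝ)⁻¹ * ∑ m, (n m : ℝ) * K ^ 2 + lam, fun f g => ?_⟩
  rw [pooledInner, pooledForm]
  have h1 : |(totalSize n : ℝ)⁻¹ * ∑ m, (n m : ℝ) * quadForm (μ m) f g| ≤
      (totalSize n : ℝ)⁻¹ * ∑ m, (n m : ℝ) * (K ^ 2 * ‖f‖ * ‖g‖) := by
    rw [abs_mul, abs_of_nonneg (by positivity)]
    gcongr
    refine (Finset.abs_sum_le_sum_abs _ _).trans (Finset.sum_le_sum fun m _ => ?_)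
    rw [abs_mul, Nat.abs_cast]
    gcongr
    exact hK.abs_quadForm_le (μ m) f g
  have h2 : |lam * inner ℝ f g| ≤ lam * (‖f‖ * ‖g‖) := by
    rw [abs_mul, abs_of_pos hlam]
    gcongr
    exact abs_real_inner_le_norm f g
  refine (abs_add_le _ _).trans ((add_le_add h1 h2).trans (le_of_eq ?_))
  simp only [← Finset.sum_mul]
  ring

variable [CompleteSpace H]

include hK in
theorem exists_pooledInner_representer (hlam : 0 < lam) (l : H →L[ℝ] ℝ) :
    ∃ f, ∀ g, pooledInner μ n lam f g = l g := by
  obtain ⟨C, hC⟩ := abs_pooledInner_le hK μ n hlam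
  simp_rw [← pooledBilin_apply hK μ n] at hC ⊢
  refine exists_representer _ hC hlam (fun f => ?_) l
  rw [pooledBilin_apply]
  exact lam_mul_sq_le_pooledInner μ n f

include hK in
theorem pooledInner_pooledKernel (hlam : 0 < lam) (x : X) (f : H) :
    pooledInner μ n lam (pooledKernel μ n lam x : H) f = f x :=
  Classical.epsilon_spec (p := fun k : H => ∀ f : H, pooledInner μ n lam k f = f x)
    (exists_pooledInner_representer hK μ n hlam (evalCLM H x)) f

include hK in
theorem pooledInner_penaltyOp (hlam : 0 < lam) (f g : H) :
    pooledInner μ n lam (penaltyOp μ n lam f) g = lam * inner ℝ f g :=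
  Classical.epsilon_spec (p := fun p : H => ∀ g : H, pooledInner μ n lam p g = lam * inner ℝ f g)
    (by simpa using exists_pooledInner_representer hK μ n hlam (lam • innerSL ℝ f)) g

/-- The score represents the derivative of the criterion at `f`. -/
theorem pooledInner_score (hlam : 0 < lam) (w : Fin (M + 1) → ℕ → ℝ) (x : Fin (M + 1) → ℕ → X)
    (y : Fin (M + 1) → ℕ → ℝ) (f g : H) (hK : BoundedEval (X := X) H K) :
    pooledInner μ n lam (score μ n lam w x y f) g =
      lam * inner ℝ f g - pooledMean n fun m i => w m i * (y m i - f (x m i)) * g (x m i) := by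
  rw [score, ← pooledBilin_apply hK]
  simp only [map_add, map_neg, map_smul, map_sum, LinearMap.add_apply, LinearMap.neg_apply,
    LinearMap.smul_apply, LinearMap.sum_apply, pooledBilin_apply,
    pooledInner_pooledKernel hK μ n hlam, pooledInner_penaltyOp hK μ n hlam, smul_eq_mul]
  rw [pooledMean]
  ring

include hK in
/-- For nonnegative weights the estimator exists and solves the normal equations. -/
theorem estimator_normal_equation (hlam : 0 < lam) {w : Fin (M + 1) → ℕ → ℝ}
    (hw : ∀ m i, 0 ≤ w m i) (x : Fin (M + 1) → ℕ → X) (y : Fin (M + 1) → ℕ → ℝ) (g : H) :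
    pooledMean n (fun m i => w m i * (y m i - estimator H n lam w x y (x m i)) * g (x m i))
      = lam * inner ℝ (estimator H n lam w x y) g := by
  obtain ⟨f, hf⟩ : ∃ f : H, ∀ g : H, (sampleBilin H n w x + lam • innerₗ H) f g
      = sampleCLM H n (fun m i => w m i * y m i) x g := by
    refine exists_representer _ (C := pooledMean n (fun m i => w m i * K ^ 2) + lam) (c := lam)
      (fun f g => ?_) hlam (fun f => ?_) _
    · simp only [LinearMap.add_apply, LinearMap.smul_apply, sampleBilin_apply, smul_eq_mul,
        innerₗ_apply_apply]
      refine (abs_add_le _ _).trans ?_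
      have e1 : |pooledMean n fun m i => w m i * (f (x m i) * g (x m i))|
          ≤ pooledMean n fun m i => (‖f‖ * ‖g‖) * (w m i * K ^ 2) := by
        refine abs_pooledMean_le n fun m i => ?_
        rw [abs_mul, abs_of_nonneg (hw m i)]
        have := mul_le_mul_of_nonneg_left (hK.abs_mul_le f g (x m i)) (hw m i)
        linarith
      rw [pooledMean_const_mul] at e1
      have e2 : |lam * inner ℝ f g| ≤ lam * (‖f‖ * ‖g‖) := by
        rw [abs_mul, abs_of_pos hlam]
        gcongr
        exact abs_real_inner_le_norm f g
      linarith
    · simp only [LinearMap.add_apply, LinearMap.smul_apply, sampleBilin_apply, smul_eq_mul,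
        innerₗ_apply_apply, real_inner_self_eq_norm_sq]
      have := pooledMean_nonneg n fun m i =>
        mul_nonneg (hw m i) (mul_self_nonneg (f (x m i)))
      linarith
  have hf' : ∀ g : H, pooledMean n (fun m i => w m i * (y m i - f (x m i)) * g (x m i))
      = lam * inner ℝ f g := by
    intro g
    have h1 := hf g
    simp only [LinearMap.add_apply, LinearMap.smul_apply, sampleBilin_apply, smul_eq_mul,
        innerₗ_apply_apply, sampleCLM_apply] at h1
    have h2 : pooledMean n (fun m i => w m i * y m i * g (x m i)) =
        pooledMean n (fun m i => w m i * (y m i - f (x m i)) * g (x m i))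
        + pooledMean n (fun m i => w m i * (f (x m i) * g (x m i))) := by
      rw [← pooledMean_add]
      congr 1
      ext m i
      ring
    linarith
  have hloss := loss_eq_of_normal_equation n w x y hf'
  have hq : ∀ g : H, 0 ≤ pooledMean n (fun m i => w m i * (g - f : H) (x m i) ^ 2) := fun g =>
    pooledMean_nonneg n fun m i => mul_nonneg (hw m i) (sq_nonneg _)
  have hmin : ∀ g : H, loss n lam w x y (estimator H n lam w x y) ≤ loss n lam w x y g :=
    Classical.epsilon_spec (p := fun f : H => ∀ g : H, loss n lam w x y f ≤ loss n lam w x y g)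
      ⟨f, fun g => by rw [hloss g]; have := hq g; nlinarith [sq_nonneg ‖g - f‖]⟩
  have h3 : ‖estimator H n lam w x y - f‖ ^ 2 ≤ 0 := by
    have h4 := hmin f
    rw [hloss (estimator H n lam w x y)] at h4
    have := hq (estimator H n lam w x y)
    by_contra! h5
    nlinarith
  have h6 : estimator H n lam w x y = f := by
    rw [← sub_eq_zero, ← norm_eq_zero, ← sq_eq_zero_iff]
    exact le_antisymm h3 (sq_nonneg _)
  rw [h6]
  exact hf' g

end Forms

/-! ### Comparison of the pooled form with the target population -/

section Comparison

variable {X H : Type*} [MeasurableSpace X] [NormedAddCommGroup H] [InnerProductSpace ℝ H]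
  [RKHS ℝ H X ℝ] {M : ℕ}

theorem UniformEquivalence.exists_le {μ : Fin (M + 1) → Measure X}
    (h : UniformEquivalence H μ) :
    ∃ b : ℝ, 1 ≤ b ∧ ∀ m (f : H), b⁻¹ * quadForm (μ 0) f f ≤ quadForm (μ m) f f := by
  obtain ⟨b, hb, h⟩ := h
  refine ⟨b, hb, fun m f => ?_⟩
  by_cases hm : m = 0
  · rw [hm]
    exact mul_le_of_le_one_left (quadForm_self_nonneg _ f) (inv_le_one_of_one_le₀ hb)
  · exact (h m hm f).1

/-- The pooled inner product dominates the one built from the target population alone. -/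
theorem target_le_mul_pooledInner {μ : Fin (M + 1) → Measure X} {n : Fin (M + 1) → ℕ} {lam b : ℝ}
    (hn : totalSize n ≠ 0) (hlam : 0 < lam) (hb : 1 ≤ b)
    (h : ∀ m (f : H), b⁻¹ * quadForm (μ 0) f f ≤ quadForm (μ m) f f) (f : H) :
    quadForm (μ 0) f f + lam * inner ℝ f f ≤ b * pooledInner μ n lam f f := by
  have hb0 : 0 < b := by linarith
  have hn' : (0 : ℝ) < totalSize n := by exact_mod_cast Nat.pos_of_ne_zero hn
  have h1 : b⁻¹ * quadForm (μ 0) f f ≤ pooledForm μ n f f := by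
    have h2 : ∑ m, (n m : ℝ) * (b⁻¹ * quadForm (μ 0) f f) ≤ ∑ m, (n m : ℝ) * quadForm (μ m) f f :=
      Finset.sum_le_sum fun m _ => mul_le_mul_of_nonneg_left (h m f) (by positivity)
    rw [← Finset.sum_mul, ← Nat.cast_sum] at h2
    rw [pooledForm, le_inv_mul_iff₀ hn']
    exact h2
  rw [pooledInner, mul_add]
  have h3 : quadForm (μ 0) f f ≤ b * pooledForm μ n f f := by
    rwa [inv_mul_le_iff₀ hb0] at h1
  have h4 : 0 ≤ lam * inner ℝ f f := mul_nonneg hlam.le real_inner_self_nonneg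
  nlinarith

/-- The dual of the pooled norm, in the coordinates that diagonalize the target problem. -/
theorem sq_le_mul_pooledInner {μ : Fin (M + 1) → Measure X} [∀ m, IsProbabilityMeasure (μ m)]
    {K : ℝ} (hK : BoundedEval (X := X) H K)
    {n : Fin (M + 1) → ℕ} {lam b : ℝ} {φ : ℕ → H} {ρ : ℕ → ℝ}
    (hA2 : SimultaneousDiagonalization (μ 0) φ ρ)
    (hn : totalSize n ≠ 0) (hlam : 0 < lam) (hb : 1 ≤ b)
    (h : ∀ m (f : H), b⁻¹ * quadForm (μ 0) f f ≤ quadForm (μ m) f f)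
    (l : H →L[ℝ] ℝ) {C : ℝ}
    (hC : ∀ s : Finset ℕ, ∑ ν ∈ s, (1 + lam * ρ ν)⁻¹ * l (φ ν) ^ 2 ≤ C) (f : H) :
    l f ^ 2 ≤ b * C * pooledInner μ n lam f f := by
  have hC0 : 0 ≤ C := by simpa using hC ∅
  let B : H →ₗ[ℝ] H →ₗ[ℝ] ℝ := quadBilin hK (μ 0) + lam • innerₗ H
  have hBapp : ∀ f g, B f g = quadForm (μ 0) f g + lam * inner ℝ f g := fun f g => by
    simp [B, quadBilin]
  have hBbound : ∀ f g, ‖B f g‖ ≤ (K ^ 2 + lam) * ‖f‖ * ‖g‖ := by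
    intro f g
    rw [hBapp, Real.norm_eq_abs]
    have h1 := hK.abs_quadForm_le (μ 0) f g
    have h2 : |lam * inner ℝ f g| ≤ lam * (‖f‖ * ‖g‖) := by
      rw [abs_mul, abs_of_pos hlam]
      gcongr
      exact abs_real_inner_le_norm f g
    refine (abs_add_le _ _).trans ((add_le_add h1 h2).trans (le_of_eq ?_))
    ring
  have hcont : Continuous fun f => B f f := by
    have : (fun f => B f f) = fun f => B.mkContinuous₂ _ hBbound f f := by
      ext f
      rw [LinearMap.mkContinuous₂_apply]
    rw [this]
    fun_prop
  have hd : ∀ ν, 0 < 1 + lam * ρ ν := fun ν => by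
    have := hA2.pos ν
    positivity
  have h1 := sq_le_of_diagonalizes B hcont hA2.basis hd (fun ν ν' => by
    rw [hBapp, hA2.form, hA2.inner]
    split_ifs <;> ring) l (C := C) (fun s => by
      simpa only [div_eq_inv_mul] using hC s) f
  have h2 := target_le_mul_pooledInner hn hlam hb h f
  rw [hBapp] at h1
  calc l f ^ 2 ≤ C * (b * pooledInner μ n lam f f) := h1.trans (by gcongr)
    _ = _ := by ring

/-- The sup norm is at most a multiple of `h^{-1/2}` times the pooled norm. -/
theorem sq_apply_le_mul_pooledInner {μ : Fin (M + 1) → Measure X} [∀ m, IsProbabilityMeasure (μ m)]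
    {K : ℝ} (hK : BoundedEval (X := X) H K)
    {n : Fin (M + 1) → ℕ} {lam b B : ℝ} {φ : ℕ → H} {ρ : ℕ → ℝ}
    (hA2 : SimultaneousDiagonalization (μ 0) φ ρ) (hB : ∀ ν x, |φ ν x| ≤ B)
    (hn : totalSize n ≠ 0) (hlam : 0 < lam) (hb : 1 ≤ b)
    (h : ∀ m (f : H), b⁻¹ * quadForm (μ 0) f f ≤ quadForm (μ m) f f)
    (hs : Summable fun ν => (1 + lam * ρ ν)⁻¹) (f : H) (x : X) :
    f x ^ 2 ≤ b * (B ^ 2 * (effDim ρ lam)⁻¹) * pooledInner μ n lam f f := by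
  have hd : ∀ ν, 0 < (1 + lam * ρ ν)⁻¹ := fun ν => by
    have := hA2.pos ν
    positivity
  refine sq_le_mul_pooledInner hK hA2 hn hlam hb h (evalCLM H x) (fun s => ?_) f
  rw [effDim, inv_inv]
  refine le_trans ?_ (mul_le_mul_of_nonneg_left (hs.sum_le_tsum s fun ν _ => (hd ν).le)
    (sq_nonneg B))
  rw [Finset.mul_sum]
  refine Finset.sum_le_sum fun ν _ => ?_
  rw [mul_comm, evalCLM_apply]
  exact mul_le_mul_of_nonneg_right (sq_le_sq' (abs_le.1 (hB ν x)).1 (abs_le.1 (hB ν x)).2) (hd ν).le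

end Comparison

/-! ### Linearization of the estimator for a fixed sample -/

section Deterministic

variable {X H : Type*} [MeasurableSpace X] [NormedAddCommGroup H] [InnerProductSpace ℝ H]
  [RKHS ℝ H X ℝ] {M : ℕ}

/-- A symmetric bilinear form whose quadratic form is small relative to that of a positive
definite `B` is small relative to `B` off the diagonal: polarization. -/
theorem abs_le_of_forall_abs_self_le (Q B : H →ₗ[ℝ] H →ₗ[ℝ] ℝ) (hQ : ∀ f g, Q f g = Q g f)
    {η : ℝ} (hB : ∀ f, f ≠ 0 → 0 < B f f) (h : ∀ f, |Q f f| ≤ η * B f f) (f g : H) :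
    |Q f g| ≤ η * (√(B f f) * √(B g g)) := by
  by_cases hf : f = 0
  · simp [hf]
  by_cases hg : g = 0
  · simp [hg]
  -- the parallelogram bound is sharp after both arguments are normalized
  have key : ∀ f g : H, 2 * |Q f g| ≤ η * (B f f + B g g) := by
    intro f g
    have h1 := h (f + g)
    have h2 := h (f - g)
    simp only [map_add, map_sub, LinearMap.add_apply, LinearMap.sub_apply] at h1 h2
    rw [abs_le] at h1 h2
    have hs := hQ f g
    have : |Q f g| ≤ η * (B f f + B g g) / 2 := by
      rw [abs_le]
      constructor <;> linarith
    linarith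
  have hF := Real.sqrt_pos.2 (hB f hf)
  have hG := Real.sqrt_pos.2 (hB g hg)
  have h1 := key ((√(B f f))⁻¹ • f) ((√(B g g))⁻¹ • g)
  simp only [map_smul, LinearMap.smul_apply, smul_eq_mul] at h1
  have e1 : (√(B f f))⁻¹ * ((√(B f f))⁻¹ * B f f) = 1 := by
    nth_rewrite 3 [← Real.mul_self_sqrt (hB f hf).le]
    field_simp
  have e2 : (√(B g g))⁻¹ * ((√(B g g))⁻¹ * B g g) = 1 := by
    nth_rewrite 3 [← Real.mul_self_sqrt (hB g hg).le]
    field_simp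
  rw [e1, e2, abs_mul, abs_mul, abs_of_pos (inv_pos.2 hF), abs_of_pos (inv_pos.2 hG)] at h1
  have h3 : (√(B g g))⁻¹ * ((√(B f f))⁻¹ * |Q f g|) ≤ η := by linarith
  rw [inv_mul_le_iff₀ hG, inv_mul_le_iff₀ hF] at h3
  linarith

/-- When the linearization error is at most half of the estimation error, the estimation error is
at most a constant times the norm of the score. -/
theorem pooledInner_self_le_of_add {μ : Fin (M + 1) → Measure X} [∀ m, IsProbabilityMeasure (μ m)]
    {K : ℝ} (hK : BoundedEval (X := X) H K) {n : Fin (M + 1) → ℕ} {lam : ℝ} (hlam : 0 < lam)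
    (d S : H) (h : pooledNorm μ n lam (d + S) ≤ 1 / 2 * pooledNorm μ n lam d) :
    pooledInner μ n lam d d ≤ 4 * pooledInner μ n lam S S := by
  have hd := pooledInner_self_nonneg μ n hlam d
  have h1 : pooledInner μ n lam (d + S) (d + S) ≤ 1 / 4 * pooledInner μ n lam d d := by
    have h2 := mul_self_le_mul_self (Real.sqrt_nonneg _) h
    simp only [pooledNorm] at h2
    rw [Real.mul_self_sqrt (pooledInner_self_nonneg μ n hlam _)] at h2
    have h3 := Real.mul_self_sqrt hd
    nlinarith
  have h4 := pooledInner_self_nonneg μ n hlam (d + S + S)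
  simp only [← pooledBilin_apply hK, map_add, LinearMap.add_apply] at *
  have h5 := pooledInner_comm μ n (lam := lam) d S
  simp only [← pooledBilin_apply hK] at h5
  linarith

variable [CompleteSpace H]

/-- The squared pooled norm of the score is at most the sum of a noise part and a bias part. -/
theorem pooledInner_score_self_le {μ : Fin (M + 1) → Measure X} [∀ m, IsProbabilityMeasure (μ m)]
    {K : ℝ} (hK : BoundedEval (X := X) H K)
    {n : Fin (M + 1) → ℕ} {lam b : ℝ} {φ : ℕ → H} {ρ : ℕ → ℝ}
    (hA2 : SimultaneousDiagonalization (μ 0) φ ρ)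
    (hn : totalSize n ≠ 0) (hlam : 0 < lam) (hb : 1 ≤ b)
    (h : ∀ m (f : H), b⁻¹ * quadForm (μ 0) f f ≤ quadForm (μ m) f f)
    (w : Fin (M + 1) → ℕ → ℝ) (x : Fin (M + 1) → ℕ → X) (y : Fin (M + 1) → ℕ → ℝ) (f : H) {t : ℝ}
    (ht : ∀ s : Finset ℕ, ∑ ν ∈ s, (1 + lam * ρ ν)⁻¹ *
      (pooledMean n fun m i => w m i * (y m i - f (x m i)) * φ ν (x m i)) ^ 2 ≤ t) :
    pooledInner μ n lam (score μ n lam w x y f) (score μ n lam w x y f)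
      ≤ 2 * (b * t + lam * ‖f‖ ^ 2) := by
  have ht0 : 0 ≤ t := by simpa using ht ∅
  set S : H := score μ n lam w x y f
  set l := sampleCLM H n (fun m i => w m i * (y m i - f (x m i))) x with hl
  have h1 : pooledInner μ n lam S S = lam * inner ℝ f S - l S := by
    rw [hl, sampleCLM_apply]
    exact pooledInner_score μ n hlam w x y f S hK
  have h2 : l S ^ 2 ≤ b * t * pooledInner μ n lam S S :=
    sq_le_mul_pooledInner hK hA2 hn hlam hb h l
      (fun s => by simpa only [hl, sampleCLM_apply] using ht s) S
  have h3 := lam_mul_sq_le_pooledInner μ n (lam := lam) S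
  have h4 : (inner ℝ f S) ^ 2 ≤ ‖f‖ ^ 2 * ‖S‖ ^ 2 := by
    rw [← mul_pow]
    exact sq_le_sq' (abs_le.1 (abs_real_inner_le_norm f S)).1
      (abs_le.1 (abs_real_inner_le_norm f S)).2
  have h5 : 0 ≤ pooledInner μ n lam S S := pooledInner_self_nonneg μ n hlam S
  set N := pooledInner μ n lam S S
  have h6 : (lam * inner ℝ f S) ^ 2 ≤ lam * ‖f‖ ^ 2 * N := by
    calc (lam * inner ℝ f S) ^ 2 = lam * (lam * (inner ℝ f S) ^ 2) := by ring
      _ ≤ lam * (lam * (‖f‖ ^ 2 * ‖S‖ ^ 2)) := by gcongr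
      _ = lam * ‖f‖ ^ 2 * (lam * ‖S‖ ^ 2) := by ring
      _ ≤ _ := by gcongr
  have h7 : N ^ 2 ≤ 2 * (b * t + lam * ‖f‖ ^ 2) * N := by
    have h8 : N ^ 2 = (lam * inner ℝ f S - l S) ^ 2 := by rw [h1]
    nlinarith [sq_nonneg (lam * inner ℝ f S + l S)]
  rcases h5.eq_or_lt with h0 | h0
  · rw [← h0]
    have : 0 ≤ b * t := mul_nonneg (by linarith) ht0
    positivity
  · rw [sq] at h7
    exact le_of_mul_le_mul_right h7 h0

/-- The deviation of the empirical quadratic form from its mean, relative to the pooled norm,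
controls the error of linearizing the estimator at `f`. -/
theorem pooledNorm_linearization_le {μ : Fin (M + 1) → Measure X} [∀ m, IsProbabilityMeasure (μ m)]
    {K : ℝ} (hK : BoundedEval (X := X) H K)
    {n : Fin (M + 1) → ℕ} {lam η : ℝ} (hlam : 0 < lam)
    {w : Fin (M + 1) → ℕ → ℝ} (hw : ∀ m i, 0 ≤ w m i)
    (x : Fin (M + 1) → ℕ → X) (y : Fin (M + 1) → ℕ → ℝ) (f : H) (hη : 0 ≤ η)
    (hQ : ∀ g : H, |pooledMean n (fun m i => w m i * (g (x m i) * g (x m i))) - pooledForm μ n g g|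
      ≤ η * pooledInner μ n lam g g) :
    pooledNorm μ n lam (estimator H n lam w x y - f + score μ n lam w x y f)
      ≤ η * pooledNorm μ n lam (estimator H n lam w x y - f) := by
  set F := estimator H n lam w x y
  set S := score μ n lam w x y f
  set u := F - f + S
  let V : H →ₗ[ℝ] H →ₗ[ℝ] ℝ := pooledBilin hK μ n lam - lam • innerₗ H
  have hV : ∀ f g, V f g = pooledForm μ n f g := fun f g => by
    simp [V, pooledBilin_apply, pooledInner]
  let Q : H →ₗ[ℝ] H →ₗ[ℝ] ℝ := sampleBilin H n w x - V
  have hQapp : ∀ f g, Q f g = pooledMean n (fun m i => w m i * (f (x m i) * g (x m i)))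
      - pooledForm μ n f g := fun f g => by
    simp [Q, hV, sampleBilin_apply]
  have hB : ∀ f, f ≠ 0 → 0 < pooledBilin hK μ n lam f f := fun f hf => by
    rw [pooledBilin_apply]
    have := norm_pos_iff.2 hf
    exact lt_of_lt_of_le (by positivity) (lam_mul_sq_le_pooledInner μ n f)
  have hQB := abs_le_of_forall_abs_self_le Q (pooledBilin hK μ n lam) (fun f g => by
    simp only [hQapp, pooledForm, quadForm_comm _ f g, mul_comm (f _)]) hB (fun g => by
      rw [hQapp, pooledBilin_apply]
      exact hQ g) (F - f) u
  -- the normal equations identify `F - f + S` as the representer of `-Q (F - f)`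
  have hu : pooledInner μ n lam u u = -Q (F - f) u := by
    have e1 : pooledInner μ n lam u u
        = pooledInner μ n lam (F - f) u + pooledInner μ n lam S u := by
      simp only [← pooledBilin_apply hK, u, map_add, LinearMap.add_apply]
      ring
    have e2 := pooledInner_score μ n hlam w x y f u hK
    have e3 := estimator_normal_equation hK n hlam hw x y u
    have e4 : pooledMean n (fun m i => w m i * (y m i - f (x m i)) * u (x m i))
        = pooledMean n (fun m i => w m i * (y m i - F (x m i)) * u (x m i))
          + pooledMean n (fun m i => w m i * ((F - f : H) (x m i) * u (x m i))) := by
      rw [← pooledMean_add]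
      congr 1
      ext m i
      simp only [RKHS.coe_sub, Pi.sub_apply]
      ring
    rw [e1, e2, hQapp, e4, e3, pooledInner, inner_sub_left]
    ring
  have hu0 := pooledInner_self_nonneg μ n hlam u
  rw [pooledBilin_apply, pooledBilin_apply] at hQB
  change √(pooledInner μ n lam u u) ≤ η * √(pooledInner μ n lam (F - f) (F - f))
  have h1 : √(pooledInner μ n lam u u) * √(pooledInner μ n lam u u)
      ≤ η * √(pooledInner μ n lam (F - f) (F - f)) * √(pooledInner μ n lam u u) := by
    rw [Real.mul_self_sqrt hu0]
    nth_rewrite 1 [hu]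
    rw [mul_assoc]
    exact (neg_le_abs _).trans hQB
  rcases (Real.sqrt_nonneg (pooledInner μ n lam u u)).eq_or_lt with h0 | h0
  · rw [← h0]
    positivity
  · exact le_of_mul_le_mul_right h1 h0

end Deterministic

/-! ### Independence and concentration of weighted samples -/

section Independence

/-- Two independent families, each made of independent variables, form independent pairs. -/
theorem iIndepFun_prodMk {Ω ι E F : Type*} [MeasurableSpace Ω] [MeasurableSpace E]
    [MeasurableSpace F] {P : Measure Ω} {U : ι → Ω → E} {V : ι → Ω → F}
    (hUm : ∀ i, Measurable (U i)) (hVm : ∀ i, Measurable (V i))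
    (hU : iIndepFun U P) (hV : iIndepFun V P)
    (hUV : IndepFun (fun o i => U i o) (fun o i => V i o) P) :
    iIndepFun (fun i o => (U i o, V i o)) P := by
  have hpair : ∀ (s : Finset ι) (A : ι → Set E) (B : ι → Set F),
      (∀ i, MeasurableSet (A i)) → (∀ i, MeasurableSet (B i)) →
      P (⋂ i ∈ s, (U i ⁻¹' A i ∩ V i ⁻¹' B i))
        = (∏ i ∈ s, P (U i ⁻¹' A i)) * ∏ i ∈ s, P (V i ⁻¹' B i) := by
    intro s A B hA hB
    have h1 := hUV.measure_inter_preimage_eq_mul (⋂ i ∈ s, Function.eval i ⁻¹' A i)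
      (⋂ i ∈ s, Function.eval i ⁻¹' B i)
      (Finset.measurableSet_biInter s fun i _ => measurable_pi_apply i (hA i))
      (Finset.measurableSet_biInter s fun i _ => measurable_pi_apply i (hB i))
    simp only [Set.preimage_iInter] at h1
    have h2 := hU.measure_inter_preimage_eq_mul s (fun i _ => hA i)
    have h3 := hV.measure_inter_preimage_eq_mul s (fun i _ => hB i)
    rw [← h2, ← h3]
    refine Eq.trans (congrArg P ?_) h1
    ext o
    simp [forall_and]
  refine iIndepSets.iIndep (fun i => ((hUm i).prodMk (hVm i)).comap_le)
    (fun i => Set.preimage (fun o => (U i o, V i o)) ''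
      Set.image2 (· ×ˢ ·) {s : Set E | MeasurableSet s} {t : Set F | MeasurableSet t})
    (fun i => isPiSystem_prod.comap _) (fun i => ?_) ?_
  · rw [← MeasurableSpace.comap_generateFrom, generateFrom_prod]
  · rw [iIndepSets_iff]
    intro s f hf
    have hf' : ∀ i, ∃ A : Set E, ∃ B : Set F, MeasurableSet A ∧ MeasurableSet B ∧
        (i ∈ s → f i = U i ⁻¹' A ∩ V i ⁻¹' B) := by
      intro i
      by_cases hi : i ∈ s
      · obtain ⟨_, ⟨A, hA, B, hB, rfl⟩, hfi⟩ := hf i hi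
        exact ⟨A, B, hA, hB, fun _ => hfi.symm⟩
      · exact ⟨∅, ∅, MeasurableSet.empty, MeasurableSet.empty, fun h => absurd h hi⟩
    choose A B hA hB hAB using hf'
    have h1 : ⋂ i ∈ s, f i = ⋂ i ∈ s, (U i ⁻¹' A i ∩ V i ⁻¹' B i) :=
      Set.iInter₂_congr hAB
    rw [h1, hpair s A B hA hB, ← Finset.prod_mul_distrib]
    refine Finset.prod_congr rfl fun i hi => ?_
    have h2 := hpair {i} A B hA hB
    simp only [Finset.mem_singleton, Set.iInter_iInter_eq_left, Finset.prod_singleton] at h2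
    rw [hAB i hi, h2]

end Independence

section Weights

variable {X Ω : Type*} [MeasurableSpace X] [MeasurableSpace Ω] {M : ℕ}

/-- The properties common to the two admissible kinds of weights: bounded by `c`, of mean one,
independent of the data, and independent triples (weight, covariate, response) within each
population. -/
structure BoundedWeights (P : Measure Ω) (W : Fin (M + 1) → ℕ → Ω → ℝ)
    (Xs : Fin (M + 1) → ℕ → Ω → X) (Ys : Fin (M + 1) → ℕ → Ω → ℝ) (c : ℝ) : Prop where
  measurable : ∀ m i, Measurable (W m i)
  one_le : 1 ≤ c
  ae_mem : ∀ m i, ∀ᵐ o ∂P, 0 < W m i o ∧ W m i o ≤ c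
  integral : ∀ m i, ∫ o, W m i o ∂P = 1
  indep_data : ∀ m i, IndepFun (W m i) (fun o => (Xs m i o, Ys m i o)) P
  indep : ∀ m, iIndepFun (fun i o => (W m i o, (Xs m i o, Ys m i o))) P

theorem IsAdmissibleWeights.exists_boundedWeights {P : Measure Ω} [IsProbabilityMeasure P]
    {μ : Fin (M + 1) → Measure X} {κ : Kernel X ℝ} {W : Fin (M + 1) → ℕ → Ω → ℝ}
    {Xs : Fin (M + 1) → ℕ → Ω → X} {Ys : Fin (M + 1) → ℕ → Ω → ℝ}
    (hdata : IsCovariateShiftData P μ κ Xs Ys) (hW : IsAdmissibleWeights P W Xs Ys) :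
    ∃ c, BoundedWeights P W Xs Ys c := by
  rcases hW with h1 | ⟨hm, hind, -, ⟨c, hc⟩, hint, -, hdat⟩
  · have hW1 : W = fun _ _ _ => 1 := by
      ext m i o
      exact h1 m i o
    subst hW1
    refine ⟨1, fun _ _ => measurable_const, le_rfl, by simp, by simp,
      fun m i => indepFun_const_left 1 _, fun m => ?_⟩
    exact (hdata.indep m).comp (fun _ p => ((1 : ℝ), p)) fun _ => by fun_prop
  · refine ⟨max c 1, hm, le_max_right _ _, fun m i => ?_, hint, fun m i => ?_, fun m => ?_⟩
    · filter_upwards [hc m i] with o ho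
      exact ⟨ho.1, ho.2.trans (le_max_left _ _)⟩
    · exact hdat.comp (measurable_pi_apply (m, i)) (measurable_pi_apply (m, i))
    · have hWm := hind.precomp (Prod.mk_right_injective m)
      refine iIndepFun_prodMk (hm m) (fun i => (hdata.measurable_X m i).prodMk
        (hdata.measurable_Y m i)) hWm (hdata.indep m) ?_
      exact hdat.comp (φ := fun w i => w (m, i)) (ψ := fun z i => z (m, i))
        (by fun_prop) (by fun_prop)

variable {P : Measure Ω} {μ : Fin (M + 1) → Measure X} {κ : Kernel X ℝ}
  {W : Fin (M + 1) → ℕ → Ω → ℝ} {Xs : Fin (M + 1) → ℕ → Ω → X} {Ys : Fin (M + 1) → ℕ → Ω → ℝ}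
  {c : ℝ}

theorem BoundedWeights.integral_mul (hdata : IsCovariateShiftData P μ κ Xs Ys)
    (hW : BoundedWeights P W Xs Ys c) {q : X × ℝ → ℝ} (hq : Measurable q)
    (m : Fin (M + 1)) (i : ℕ) :
    ∫ o, W m i o * q (Xs m i o, Ys m i o) ∂P = ∫ z, q z ∂(μ m ⊗ₘ κ) := by
  have hXY := (hdata.measurable_X m i).prodMk (hdata.measurable_Y m i)
  have h1 : IndepFun (W m i) (fun o => q (Xs m i o, Ys m i o)) P :=
    (hW.indep_data m i).comp measurable_id hq
  rw [h1.integral_fun_mul_eq_mul_integral (hW.measurable m i).aestronglyMeasurable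
    (hq.comp hXY).aestronglyMeasurable, hW.integral, one_mul, ← hdata.law m i,
    integral_map hXY.aemeasurable hq.aestronglyMeasurable]

variable [IsProbabilityMeasure P] [∀ m, IsProbabilityMeasure (μ m)] [IsMarkovKernel κ]

/-- **Hoeffding's inequality** for the weighted sample sums of a bounded function. -/
theorem BoundedWeights.measure_abs_sum_gt_le (hdata : IsCovariateShiftData P μ κ Xs Ys)
    (hW : BoundedWeights P W Xs Ys c) {q : X → ℝ} (hq : Measurable q) {s : ℝ} (hs : 0 < s)
    (hqs : ∀ x, |q x| ≤ s) (m : Fin (M + 1)) {N n : ℕ} (hN : N ≤ n) {u : ℝ} (hu : 0 < u) :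
    P {o | √(2 * n) * (c * s) * u <
        |∑ i ∈ Finset.range N, (W m i o * q (Xs m i o) - ∫ x, q x ∂(μ m))|}
      ≤ ENNReal.ofReal (2 * Real.exp (-u ^ 2)) := by
  have hc : 0 < c := lt_of_lt_of_le one_pos hW.one_le
  rcases Nat.eq_zero_or_pos N with rfl | hN0
  · have : ¬ √(2 * n) * (c * s) * u < 0 := not_lt.2 (by positivity)
    simp only [Finset.range_zero, Finset.sum_empty, abs_zero, this, Set.ofPred_false,
      measure_empty, zero_le]
  have hmeas : ∀ i, Measurable fun o => W m i o * q (Xs m i o) := fun i =>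
    (hW.measurable m i).mul (hq.comp (hdata.measurable_X m i))
  have hint : ∀ i, ∫ o, W m i o * q (Xs m i o) ∂P = ∫ x, q x ∂(μ m) := fun i => by
    have h1 := hW.integral_mul hdata (hq.comp measurable_fst) m i
    simp only [Function.comp_apply] at h1
    have h2 : ∫ x, q x ∂(μ m ⊗ₘ κ).fst = ∫ z, q z.1 ∂(μ m ⊗ₘ κ) :=
      integral_map measurable_fst.aemeasurable hq.aestronglyMeasurable
    rw [h1, ← h2, Measure.fst_compProd]
  have hsub : ∀ i, HasSubgaussianMGF (fun o => W m i o * q (Xs m i o) - ∫ x, q x ∂(μ m))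
      ((‖c * s - -(c * s)‖₊ / 2) ^ 2) P := by
    intro i
    rw [← hint i]
    refine hasSubgaussianMGF_of_mem_Icc (hmeas i).aemeasurable ?_
    filter_upwards [hW.ae_mem m i] with o ho
    rw [Set.mem_Icc, ← abs_le, abs_mul, abs_of_pos ho.1]
    exact mul_le_mul ho.2 (hqs _) (abs_nonneg _) hc.le
  have hind : iIndepFun (fun i o => W m i o * q (Xs m i o) - ∫ x, q x ∂(μ m)) P :=
    (hW.indep m).comp (fun _ z => z.1 * q z.2.1 - ∫ x, q x ∂(μ m)) fun _ => by fun_prop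
  have hsum := HasSubgaussianMGF.sum_of_iIndepFun hind (s := Finset.range N) fun i _ => hsub i
  have hpar : ((∑ i ∈ Finset.range N, (‖c * s - -(c * s)‖₊ / 2) ^ 2 : ℝ≥0) : ℝ)
      = N * (c * s) ^ 2 := by
    rw [Finset.sum_const, Finset.card_range]
    simp only [nsmul_eq_mul, NNReal.coe_mul, NNReal.coe_natCast, NNReal.coe_pow, NNReal.coe_div,
      coe_nnnorm, NNReal.coe_ofNat, sub_neg_eq_add, ← two_mul, Real.norm_eq_abs]
    rw [abs_of_pos (by positivity)]
    ring
  have ht : 0 ≤ √(2 * n) * (c * s) * u := by positivity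
  have hexp : Real.exp (-(√(2 * n) * (c * s) * u) ^ 2 / (2 * (N * (c * s) ^ 2)))
      ≤ Real.exp (-u ^ 2) := by
    apply Real.exp_le_exp.2
    have hNr : (0 : ℝ) < N := by exact_mod_cast hN0
    have hNn : (N : ℝ) ≤ n := by exact_mod_cast hN
    rw [div_le_iff₀ (by positivity), mul_pow, mul_pow, Real.sq_sqrt (by positivity)]
    have : 0 ≤ (c * s) ^ 2 * u ^ 2 := by positivity
    nlinarith
  have h1 := hsum.measure_ge_le ht
  have h2 := hsum.neg.measure_ge_le ht
  rw [hpar] at h1 h2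
  have key : ∀ {S : Set Ω}, P.real S ≤ Real.exp (-u ^ 2) →
      P S ≤ ENNReal.ofReal (Real.exp (-u ^ 2)) := fun h => by
    rw [← ENNReal.ofReal_toReal (measure_ne_top P _)]
    exact ENNReal.ofReal_le_ofReal h
  rw [two_mul (Real.exp _), ENNReal.ofReal_add (Real.exp_pos _).le (Real.exp_pos _).le]
  refine le_trans (measure_mono ?_) ((measure_union_le _ _).trans
    (add_le_add (key (h1.trans hexp)) (key (h2.trans hexp))))
  intro o ho
  rw [Set.mem_ofPred_eq, lt_abs] at ho
  rcases ho with h | h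
  · exact Or.inl h.le
  · exact Or.inr h.le

end Weights

/-! ### The noise part of the score -/

section Noise

variable {X H Ω : Type*} [MeasurableSpace X] [MeasurableSpace Ω] {M : ℕ}
  [NormedAddCommGroup H] [InnerProductSpace ℝ H] [RKHS ℝ H X ℝ]
  {P : Measure Ω} [IsProbabilityMeasure P]
  {μ : Fin (M + 1) → Measure X} [∀ m, IsProbabilityMeasure (μ m)] {κ : Kernel X ℝ}
  [IsMarkovKernel κ] {W : Fin (M + 1) → ℕ → Ω → ℝ}
  {Xs : Fin (M + 1) → ℕ → Ω → X} {Ys : Fin (M + 1) → ℕ → Ω → ℝ} {c : ℝ}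

theorem MomentCondition.exists_lintegral_le {f : H} (hf : Measurable (f : X → ℝ))
    (hA3 : MomentCondition μ κ f) : ∃ C : ℝ, 0 < C ∧ ∀ m,
      ∫⁻ z, ENNReal.ofReal ((z.2 - f z.1) ^ 2) ∂(μ m ⊗ₘ κ) ≤ ENNReal.ofReal C := by
  choose C hC h using hA3
  refine ⟨∑ m, C m, Finset.sum_pos (fun m _ => hC m) Finset.univ_nonempty, fun m => ?_⟩
  have hm : Measurable fun z : X × ℝ => ENNReal.ofReal ((z.2 - f z.1) ^ 2) := by fun_prop
  rw [Measure.lintegral_compProd hm]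
  calc ∫⁻ x, ∫⁻ y, ENNReal.ofReal ((y - f x) ^ 2) ∂(κ x) ∂(μ m)
      ≤ ∫⁻ _, ENNReal.ofReal (C m) ∂(μ m) := by
        refine lintegral_mono_ae ?_
        filter_upwards [h m] with x hx
        simpa only [sq_abs] using hx.2.1
    _ = ENNReal.ofReal (C m) := by simp
    _ ≤ _ := ENNReal.ofReal_le_ofReal
        (Finset.single_le_sum (fun m _ => (hC m).le) (Finset.mem_univ m))

/-- The bound is finite whatever the sign of `C`, because `ENNReal.ofReal` is. -/
theorem memLp_two_of_lintegral_sq_le {Ω' : Type*} [MeasurableSpace Ω'] {ν : Measure Ω'}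
    {e : Ω' → ℝ} (he : Measurable e) {C : ℝ}
    (h : ∫⁻ z, ENNReal.ofReal (e z ^ 2) ∂ν ≤ ENNReal.ofReal C) : MemLp e 2 ν := by
  rw [memLp_two_iff_integrable_sq he.aestronglyMeasurable]
  refine ⟨(he.pow_const 2).aestronglyMeasurable, ?_⟩
  rw [hasFiniteIntegral_iff_ofReal (ae_of_all _ fun z => sq_nonneg _)]
  exact lt_of_le_of_lt h ENNReal.ofReal_lt_top

/-- The errors are uncorrelated with every bounded function of the covariate. -/
theorem integral_error_mul_eq_zero {f : H} (hf : Measurable (f : X → ℝ))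
    (hmean : IsCondMean μ κ f) {C : ℝ} {m : Fin (M + 1)}
    (hC : ∫⁻ z, ENNReal.ofReal ((z.2 - f z.1) ^ 2) ∂(μ m ⊗ₘ κ) ≤ ENNReal.ofReal C)
    {q : X → ℝ} (hq : Measurable q) {B : ℝ} (hB : ∀ x, |q x| ≤ B) :
    ∫ z, (z.2 - f z.1) * q z.1 ∂(μ m ⊗ₘ κ) = 0 := by
  have he : Measurable fun z : X × ℝ => z.2 - f z.1 := by fun_prop
  have hint : Integrable (fun z : X × ℝ => z.2 - f z.1) (μ m ⊗ₘ κ) :=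
    (memLp_two_of_lintegral_sq_le he hC).integrable (by norm_num)
  have hint' : Integrable (fun z : X × ℝ => (z.2 - f z.1) * q z.1) (μ m ⊗ₘ κ) :=
    hint.mul_bdd (hq.comp measurable_fst).aestronglyMeasurable (ae_of_all _ fun z => hB z.1)
  rw [Measure.integral_compProd hint']
  refine integral_eq_zero_of_ae ?_
  filter_upwards [hmean m, ((Measure.integrable_compProd_iff he.aestronglyMeasurable).1 hint).1]
    with x hx hix
  have hy : Integrable (fun y : ℝ => y) (κ x) :=
    (hix.add (integrable_const (f x))).congr (ae_of_all _ fun y => by simp)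
  simp only [Pi.zero_apply]
  rw [integral_mul_const, integral_sub hy (integrable_const _), ← hx]
  simp

/-- The second moment of the noise term tested against a bounded function. -/
theorem lintegral_pooledMean_error_sq_le (hdata : IsCovariateShiftData P μ κ Xs Ys)
    (hW : BoundedWeights P W Xs Ys c) {f : H} (hf : Measurable (f : X → ℝ))
    (hmean : IsCondMean μ κ f) {C : ℝ} (hC0 : 0 < C)
    (hC : ∀ m, ∫⁻ z, ENNReal.ofReal ((z.2 - f z.1) ^ 2) ∂(μ m ⊗ₘ κ) ≤ ENNReal.ofReal C)
    {q : X → ℝ} (hq : Measurable q) {B : ℝ} (hB : ∀ x, |q x| ≤ B) {n : Fin (M + 1) → ℕ}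
    (hn : totalSize n ≠ 0) :
    ∫⁻ o, ENNReal.ofReal ((pooledMean n fun m i =>
        W m i o * (Ys m i o - f (Xs m i o)) * q (Xs m i o)) ^ 2) ∂P
      ≤ ENNReal.ofReal ((M + 1) * (c ^ 2 * B ^ 2 * C) / totalSize n) := by
  have hc : 0 < c := lt_of_lt_of_le one_pos hW.one_le
  have hn' : (0 : ℝ) < totalSize n := by exact_mod_cast Nat.pos_of_ne_zero hn
  let ξ : Fin (M + 1) → ℕ → Ω → ℝ := fun m i o =>
    W m i o * (Ys m i o - f (Xs m i o)) * q (Xs m i o)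
  have hξm : ∀ m i, Measurable (ξ m i) := fun m i =>
    ((hW.measurable m i).mul ((hdata.measurable_Y m i).sub (hf.comp (hdata.measurable_X m i)))).mul
      (hq.comp (hdata.measurable_X m i))
  have hξ2 : ∀ m i, ∫⁻ o, ENNReal.ofReal (ξ m i o ^ 2) ∂P
      ≤ ENNReal.ofReal (c ^ 2 * B ^ 2 * C) := by
    intro m i
    have he : Measurable fun z : X × ℝ => ENNReal.ofReal ((z.2 - f z.1) ^ 2) := by fun_prop
    calc ∫⁻ o, ENNReal.ofReal (ξ m i o ^ 2) ∂P
        ≤ ∫⁻ o, ENNReal.ofReal (c ^ 2 * B ^ 2) *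
            ENNReal.ofReal ((Ys m i o - f (Xs m i o)) ^ 2) ∂P := by
          refine lintegral_mono_ae ?_
          filter_upwards [hW.ae_mem m i] with o ho
          rw [← ENNReal.ofReal_mul (by positivity)]
          apply ENNReal.ofReal_le_ofReal
          have h1 : W m i o ^ 2 ≤ c ^ 2 := pow_le_pow_left₀ ho.1.le ho.2 2
          have h2 : q (Xs m i o) ^ 2 ≤ B ^ 2 := sq_le_sq' (abs_le.1 (hB _)).1 (abs_le.1 (hB _)).2
          calc ξ m i o ^ 2
              = W m i o ^ 2 * q (Xs m i o) ^ 2 * (Ys m i o - f (Xs m i o)) ^ 2 := by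
                simp only [ξ]; ring
            _ ≤ _ := by gcongr
      _ = ENNReal.ofReal (c ^ 2 * B ^ 2) *
            ∫⁻ z, ENNReal.ofReal ((z.2 - f z.1) ^ 2) ∂(μ m ⊗ₘ κ) := by
          rw [lintegral_const_mul' _ _ ENNReal.ofReal_ne_top, ← hdata.law m i,
            lintegral_map he ((hdata.measurable_X m i).prodMk (hdata.measurable_Y m i))]
      _ ≤ ENNReal.ofReal (c ^ 2 * B ^ 2) * ENNReal.ofReal C := by gcongr; exact hC m
      _ = _ := (ENNReal.ofReal_mul (by positivity)).symm
  have hξL : ∀ m i, MemLp (ξ m i) 2 P := fun m i => memLp_two_of_lintegral_sq_le (hξm m i) (hξ2 m i)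
  have hξ0 : ∀ m i, ∫ o, ξ m i o ∂P = 0 := by
    intro m i
    rw [← integral_error_mul_eq_zero hf hmean (hC m) hq hB, ← hW.integral_mul hdata
      (q := fun z => (z.2 - f z.1) * q z.1) (by fun_prop) m i]
    simp only [ξ, mul_assoc]
  have hind : ∀ m, iIndepFun (ξ m) P := fun m =>
    (hW.indep m).comp (fun _ z => z.1 * (z.2.2 - f z.2.1) * q z.2.1) fun _ => by fun_prop
  have hS : ∀ m, ∫⁻ o, ENNReal.ofReal ((∑ i ∈ Finset.range (n m), ξ m i o) ^ 2) ∂P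
      ≤ ENNReal.ofReal (n m * (c ^ 2 * B ^ 2 * C)) := by
    intro m
    have hSL : MemLp (∑ i ∈ Finset.range (n m), ξ m i) 2 P := memLp_finsetSum' _ fun i _ => hξL m i
    have hvar : ∫ o, (∑ i ∈ Finset.range (n m), ξ m i o) ^ 2 ∂P
        ≤ n m * (c ^ 2 * B ^ 2 * C) := by
      have h1 := IndepFun.variance_sum (X := ξ m) (s := Finset.range (n m)) (μ := P)
        (fun i _ => hξL m i) (fun i _ j _ hij => (hind m).indepFun hij)
      have h0 : ∫ o, (∑ i ∈ Finset.range (n m), ξ m i) o ∂P = 0 := by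
        simp only [Finset.sum_apply]
        rw [integral_finsetSum _ fun i _ => (hξL m i).integrable (by norm_num)]
        simp [hξ0]
      rw [variance_of_integral_eq_zero hSL.aemeasurable h0] at h1
      simp only [Finset.sum_apply] at h1
      rw [h1]
      have h2 : ∀ i, variance (ξ m i) P ≤ c ^ 2 * B ^ 2 * C := by
        intro i
        refine (variance_le_expectation_sq (hξm m i).aestronglyMeasurable).trans ?_
        simp only [Pi.pow_apply]
        rw [integral_eq_lintegral_of_nonneg_ae (ae_of_all _ fun o => sq_nonneg _)
          ((hξm m i).pow_const 2).aestronglyMeasurable]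
        exact ENNReal.toReal_le_of_le_ofReal (by positivity) (hξ2 m i)
      refine (Finset.sum_le_sum fun i _ => h2 i).trans (le_of_eq ?_)
      simp
    rw [← ofReal_integral_eq_lintegral_ofReal ?_ (ae_of_all _ fun o => sq_nonneg _)]
    · exact ENNReal.ofReal_le_ofReal hvar
    · simpa using hSL.integrable_sq
  calc ∫⁻ o, ENNReal.ofReal ((pooledMean n fun m i => ξ m i o) ^ 2) ∂P
      ≤ ∫⁻ o, ENNReal.ofReal (((totalSize n : ℝ)⁻¹) ^ 2 * (M + 1)) *
          ∑ m, ENNReal.ofReal ((∑ i ∈ Finset.range (n m), ξ m i o) ^ 2) ∂P := by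
        refine lintegral_mono fun o => ?_
        dsimp only
        rw [← ENNReal.ofReal_sum_of_nonneg (fun m _ => sq_nonneg _),
          ← ENNReal.ofReal_mul (by positivity)]
        apply ENNReal.ofReal_le_ofReal
        rw [pooledMean, mul_pow, mul_assoc]
        gcongr
        have := sq_sum_le_card_mul_sum_sq (s := (Finset.univ : Finset (Fin (M + 1))))
          (f := fun m => ∑ i ∈ Finset.range (n m), ξ m i o)
        simpa using this
    _ = ENNReal.ofReal (((totalSize n : ℝ)⁻¹) ^ 2 * (M + 1)) *
          ∑ m, ∫⁻ o, ENNReal.ofReal ((∑ i ∈ Finset.range (n m), ξ m i o) ^ 2) ∂P := by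
        rw [lintegral_const_mul' _ _ ENNReal.ofReal_ne_top, lintegral_finsetSum]
        intro m _
        exact ((Finset.measurable_fun_sum _ fun i _ => hξm m i).pow_const 2).ennreal_ofReal
    _ ≤ ENNReal.ofReal (((totalSize n : ℝ)⁻¹) ^ 2 * (M + 1)) *
          ∑ m, ENNReal.ofReal (n m * (c ^ 2 * B ^ 2 * C)) := by
        gcongr with m
        exact hS m
    _ = _ := by
        rw [← ENNReal.ofReal_sum_of_nonneg (fun m _ => by positivity),
          ← ENNReal.ofReal_mul (by positivity), ← Finset.sum_mul, ← Nat.cast_sum]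
        congr 1
        change _ * ((totalSize n : ℝ) * _) = _
        field_simp

/-- With high probability the dual norm of the noise functional is of order `(n h)^{-1/2}`. -/
theorem measure_noise_gt_le (hdata : IsCovariateShiftData P μ κ Xs Ys)
    (hW : BoundedWeights P W Xs Ys c) {f : H} (hmeas : ∀ f : H, Measurable (f : X → ℝ))
    (hmean : IsCondMean μ κ f) {C : ℝ} (hC0 : 0 < C)
    (hC : ∀ m, ∫⁻ z, ENNReal.ofReal ((z.2 - f z.1) ^ 2) ∂(μ m ⊗ₘ κ) ≤ ENNReal.ofReal C)
    {φ : ℕ → H} {ρ : ℕ → ℝ} (hρ : ∀ ν, 0 < ρ ν) {B : ℝ} (hB : ∀ ν x, |φ ν x| ≤ B)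
    {n : Fin (M + 1) → ℕ} (hn : totalSize n ≠ 0) {lam : ℝ} (hlam : 0 < lam)
    (hs : Summable fun ν => (1 + lam * ρ ν)⁻¹) {δ : ℝ} (hδ : 0 < δ) :
    P {o | ∃ s : Finset ℕ, (M + 1) * (c ^ 2 * B ^ 2 * C) / (totalSize n * effDim ρ lam * δ) <
        ∑ ν ∈ s, (1 + lam * ρ ν)⁻¹ * (pooledMean n fun m i =>
          W m i o * (Ys m i o - f (Xs m i o)) * φ ν (Xs m i o)) ^ 2} ≤ ENNReal.ofReal δ := by
  have hd : ∀ ν, 0 < (1 + lam * ρ ν)⁻¹ := fun ν => by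
    have := hρ ν
    positivity
  have hn' : (0 : ℝ) < totalSize n := by exact_mod_cast Nat.pos_of_ne_zero hn
  have hh : 0 < effDim ρ lam := inv_pos.2 (hs.tsum_pos (fun ν => (hd ν).le) 0 (hd 0))
  set A : ℕ → Ω → ℝ := fun ν o => pooledMean n fun m i =>
    W m i o * (Ys m i o - f (Xs m i o)) * φ ν (Xs m i o) with hA
  have hAm : ∀ ν, Measurable (A ν) := fun ν => by
    refine measurable_const.mul (Finset.measurable_fun_sum _ fun m _ =>
      Finset.measurable_fun_sum _ fun i _ => ?_)
    exact ((hW.measurable m i).mul ((hdata.measurable_Y m i).sub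
      ((hmeas f).comp (hdata.measurable_X m i)))).mul ((hmeas (φ ν)).comp (hdata.measurable_X m i))
  set E : ℝ := (M + 1) * (c ^ 2 * B ^ 2 * C) / totalSize n with hE
  have hE0 : 0 ≤ E := by positivity
  let T : Ω → ℝ≥0∞ := fun o => ∑' ν, ENNReal.ofReal ((1 + lam * ρ ν)⁻¹ * A ν o ^ 2)
  have hT : ∫⁻ o, T o ∂P ≤ ENNReal.ofReal ((effDim ρ lam)⁻¹ * E) := by
    have hterm : ∀ ν, Measurable fun o => ENNReal.ofReal ((1 + lam * ρ ν)⁻¹ * A ν o ^ 2) :=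
      fun ν => (((hAm ν).pow_const 2).const_mul _).ennreal_ofReal
    rw [lintegral_tsum fun ν => (hterm ν).aemeasurable, effDim, inv_inv, ← tsum_mul_right,
      ENNReal.ofReal_tsum_of_nonneg (fun ν => mul_nonneg (hd ν).le hE0) (hs.mul_right E)]
    refine ENNReal.tsum_le_tsum fun ν => ?_
    simp_rw [ENNReal.ofReal_mul (hd ν).le]
    rw [lintegral_const_mul' _ _ ENNReal.ofReal_ne_top]
    gcongr
    exact lintegral_pooledMean_error_sq_le hdata hW (hmeas f) hmean hC0 hC (hmeas (φ ν)) (hB ν) hn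
  set t : ℝ := (M + 1) * (c ^ 2 * B ^ 2 * C) / (totalSize n * effDim ρ lam * δ) with ht
  have htE : (effDim ρ lam)⁻¹ * E = δ * t := by
    rw [ht, hE]
    field_simp
  have ht0 : 0 ≤ t := by positivity
  have hTm : Measurable T := Measurable.tsum fun ν =>
    (((hAm ν).pow_const 2).const_mul _).ennreal_ofReal
  have hsub : {o | ∃ s : Finset ℕ, t < ∑ ν ∈ s, (1 + lam * ρ ν)⁻¹ * A ν o ^ 2}
      ⊆ {o | ENNReal.ofReal t < T o} := by
    rintro o ⟨s, hso⟩
    refine lt_of_lt_of_le ((ENNReal.ofReal_lt_ofReal_iff (lt_of_le_of_lt ht0 hso)).2 hso) ?_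
    rw [ENNReal.ofReal_sum_of_nonneg fun ν _ => mul_nonneg (hd ν).le (sq_nonneg _)]
    exact ENNReal.sum_le_tsum s
  refine (measure_mono hsub).trans ?_
  rw [htE] at hT
  rcases ht0.eq_or_lt with h0 | h0
  · rw [← h0] at hT ⊢
    have hT0 : ∫⁻ o, T o ∂P = 0 := by simpa using hT
    rw [lintegral_eq_zero_iff hTm] at hT0
    have : P {o | ENNReal.ofReal 0 < T o} = 0 := by
      rw [measure_eq_zero_iff_ae_notMem]
      filter_upwards [hT0] with o ho
      simp [ho]
    rw [this]
    exact zero_le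
  · have h1 := mul_meas_ge_le_lintegral (μ := P) hTm (ENNReal.ofReal t)
    have hle : P {o | ENNReal.ofReal t < T o} ≤ P {o | ENNReal.ofReal t ≤ T o} :=
      measure_mono fun o (ho : ENNReal.ofReal t < T o) => ho.le
    have h2 : ENNReal.ofReal t * P {o | ENNReal.ofReal t < T o}
        ≤ ENNReal.ofReal t * ENNReal.ofReal δ := by
      rw [← ENNReal.ofReal_mul ht0, mul_comm t δ]
      exact (mul_le_mul' le_rfl hle).trans (h1.trans hT)
    exact (ENNReal.mul_le_mul_iff_right (ENNReal.ofReal_pos.2 h0).ne' ENNReal.ofReal_ne_top).1 h2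

end Noise

/-! ### Uniform deviation of the empirical quadratic form -/

section Deviation

theorem edist_ofFun_le_iff {X : Type*} {f g : X → ℝ} {r : ℝ} (hr : 0 ≤ r) :
    edist (UniformFun.ofFun f) (UniformFun.ofFun g) ≤ ENNReal.ofReal r ↔ ∀ x, |f x - g x| ≤ r := by
  rw [UniformFun.edist_le]
  refine forall_congr' fun x => ?_
  rw [edist_dist, ENNReal.ofReal_le_ofReal_iff hr, Real.dist_eq]
  rfl

variable {X H Ω : Type*} [MeasurableSpace X] [MeasurableSpace Ω] {M : ℕ}
  [NormedAddCommGroup H] [InnerProductSpace ℝ H] [RKHS ℝ H X ℝ]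
  {P : Measure Ω} [IsProbabilityMeasure P]
  {μ : Fin (M + 1) → Measure X} [∀ m, IsProbabilityMeasure (μ m)] {κ : Kernel X ℝ}
  [IsMarkovKernel κ] {W : Fin (M + 1) → ℕ → Ω → ℝ}
  {Xs : Fin (M + 1) → ℕ → Ω → X} {Ys : Fin (M + 1) → ℕ → Ω → ℝ} {c : ℝ}

/-- Uniform deviation of the weighted second moments of one population over a class of functions
bounded by `R`. The increments of the process are sub-Gaussian for the sup distance because
`f² - g² = (f - g) (f + g)`. -/
theorem measure_exists_sq_deviation_gt_le (hdata : IsCovariateShiftData P μ κ Xs Ys)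
    (hW : BoundedWeights P W Xs Ys c) (hmeas : ∀ f : H, Measurable (f : X → ℝ)) {F : Set H}
    (hF0 : 0 ∈ F) {R : ℝ} (hR : 0 < R) (hFR : ∀ f ∈ F, ∀ x, |f x| ≤ R) (m : Fin (M + 1)) {N n : ℕ}
    (hN : N ≤ n) (hn : n ≠ 0) {L δ : ℝ}
    (hL0 : 0 < L) (hL : 2 ≤ L ^ 2) (hδ : 0 < δ) (hδ1 : δ ≤ 1) (hLδ : Real.exp (-L ^ 2) ≤ δ / 4)
    (ha : ∫⁻ ε in Set.Ioc (0 : ℝ) 1, psi2Inv (supCoveringNumber F ε.toNNReal) ≠ ⊤) :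
    P {o | ∃ f ∈ F, 10 * (R + 3) * L * (√(2 * n) * (c * (2 * R))) *
        (∫⁻ ε in Set.Ioc (0 : ℝ) 1, psi2Inv (supCoveringNumber F ε.toNNReal)).toReal <
        |∑ i ∈ Finset.range N, (W m i o * f (Xs m i o) ^ 2 - ∫ x, f x ^ 2 ∂(μ m))|}
      ≤ ENNReal.ofReal δ := by
  have hc : 0 < c := lt_of_lt_of_le one_pos hW.one_le
  have hn' : (0 : ℝ) < n := by exact_mod_cast Nat.pos_of_ne_zero hn
  set A : Set (UniformFun X ℝ) := (fun f : H => UniformFun.ofFun (f : X → ℝ)) '' F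
  let Z : UniformFun X ℝ → Ω → ℝ := fun t o => ∑ i ∈ Finset.range N,
    (W m i o * UniformFun.toFun t (Xs m i o) ^ 2 - ∫ x, UniformFun.toFun t x ^ 2 ∂(μ m))
  have hZf : ∀ (f : H) o, Z (UniformFun.ofFun f) o
      = ∑ i ∈ Finset.range N, (W m i o * f (Xs m i o) ^ 2 - ∫ x, f x ^ 2 ∂(μ m)) := fun f o => rfl
  have hint : ∀ f ∈ F, Integrable (fun x => f x ^ 2) (μ m) := fun f hf =>
    Integrable.of_bound ((hmeas f).pow_const 2).aestronglyMeasurable (R ^ 2)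
      (ae_of_all _ fun x => by
        rw [Real.norm_eq_abs, abs_pow]
        exact pow_le_pow_left₀ (abs_nonneg _) (hFR f hf x) 2)
  have hZsub : ∀ f ∈ F, ∀ g ∈ F, ∀ o, Z (UniformFun.ofFun f) o - Z (UniformFun.ofFun g) o
      = ∑ i ∈ Finset.range N, (W m i o * (f (Xs m i o) ^ 2 - g (Xs m i o) ^ 2)
        - ∫ x, f x ^ 2 - g x ^ 2 ∂(μ m)) := by
    intro f hf g hg o
    rw [hZf, hZf, ← Finset.sum_sub_distrib, integral_sub (hint f hf) (hint g hg)]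
    refine Finset.sum_congr rfl fun i _ => ?_
    ring
  have hsq : ∀ f ∈ F, ∀ g ∈ F, ∀ r, (∀ x, |f x - g x| ≤ r) →
      ∀ x, |f x ^ 2 - g x ^ 2| ≤ 2 * R * r := by
    intro f hf g hg r hr x
    have h1 : |f x + g x| ≤ 2 * R := by
      have := abs_add_le (f x) (g x)
      linarith [hFR f hf x, hFR g hg x]
    rw [sq_sub_sq, abs_mul]
    exact mul_le_mul h1 (hr x) (abs_nonneg _) (by positivity)
  have hZ0 : ∀ o, Z (UniformFun.ofFun (0 : H)) o = 0 := fun o => by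
    rw [hZf]
    simp
  have key := measure_exists_increment_gt_le (P := P) (A := A) (Z := Z)
    (t₀ := UniformFun.ofFun (0 : H)) ⟨0, hF0, rfl⟩ (R := R) (σ := √(2 * n) * (c * (2 * R)))
    hR.le (by positivity) ?_ ?_ ?_ hL0 hL hδ hδ1 hLδ ha
  · refine le_trans (measure_mono ?_) key
    rintro o ⟨f, hf, hfo⟩
    refine ⟨_, ⟨f, hf, rfl⟩, ?_⟩
    rw [hZ0, sub_zero, hZf]
    exact hfo
  · rintro _ ⟨f, hf, rfl⟩
    rw [edist_ofFun_le_iff hR.le]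
    intro x
    simpa using hFR f hf x
  · rintro _ ⟨f, hf, rfl⟩ _ ⟨g, hg, rfl⟩ r hr hfg u hu
    rw [edist_ofFun_le_iff hr.le] at hfg
    have h1 := hW.measure_abs_sum_gt_le hdata (q := fun x => f x ^ 2 - g x ^ 2)
      (((hmeas f).pow_const 2).sub ((hmeas g).pow_const 2)) (by positivity : 0 < 2 * R * r)
      (hsq f hf g hg r hfg) m hN hu
    refine le_trans (measure_mono ?_) h1
    intro o ho
    rw [Set.mem_ofPred_eq] at ho ⊢
    rw [hZsub f hf g hg] at ho
    refine lt_of_eq_of_lt ?_ ho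
    ring
  · filter_upwards [ae_all_iff.2 (hW.ae_mem m)] with o ho
    refine ⟨N * ((c + 1) * (2 * R)), ?_⟩
    rintro _ ⟨f, hf, rfl⟩ _ ⟨g, hg, rfl⟩ r hr hfg
    rw [edist_ofFun_le_iff hr.le] at hfg
    have h1 := hsq f hf g hg r hfg
    have h2 : |∫ x, f x ^ 2 - g x ^ 2 ∂(μ m)| ≤ 2 * R * r := by
      have := norm_integral_le_of_norm_le_const (μ := μ m) (f := fun x => f x ^ 2 - g x ^ 2)
        (ae_of_all _ h1)
      simpa using this
    rw [hZsub f hf g hg]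
    refine (Finset.abs_sum_le_sum_abs _ _).trans ?_
    calc ∑ i ∈ Finset.range N, |W m i o * (f (Xs m i o) ^ 2 - g (Xs m i o) ^ 2)
          - ∫ x, f x ^ 2 - g x ^ 2 ∂(μ m)|
        ≤ ∑ i ∈ Finset.range N, (c * (2 * R * r) + 2 * R * r) := by
          refine Finset.sum_le_sum fun i _ => (abs_sub _ _).trans (add_le_add ?_ h2)
          rw [abs_mul, abs_of_pos (ho i).1]
          exact mul_le_mul (ho i).2 (h1 _) (abs_nonneg _) hc.le
      _ = _ := by
          rw [Finset.sum_const, Finset.card_range, nsmul_eq_mul]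
          ring

/-- The empirical quadratic form deviates from its mean, relative to the squared pooled norm, by at
most a multiple of `a_λ / √(n h²)` with high probability. -/
theorem measure_exists_form_deviation_gt_le (hdata : IsCovariateShiftData P μ κ Xs Ys)
    (hW : BoundedWeights P W Xs Ys c) {K : ℝ} (hK : BoundedEval (X := X) H K)
    {n : Fin (M + 1) → ℕ} {lam b B c₁ : ℝ} {φ : ℕ → H} {ρ : ℕ → ℝ}
    (hA2 : SimultaneousDiagonalization (μ 0) φ ρ) (hB0 : 0 ≤ B) (hB : ∀ ν x, |φ ν x| ≤ B)
    (hn : totalSize n ≠ 0) (hlam : 0 < lam) (hb : 1 ≤ b)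
    (h : ∀ m (f : H), b⁻¹ * quadForm (μ 0) f f ≤ quadForm (μ m) f f)
    (hs : Summable fun ν => (1 + lam * ρ ν)⁻¹) (hc₁ : 0 < c₁) {R : ℝ} (hR : 0 < R)
    (hRb : √b * B / c₁ ≤ R) {L δ : ℝ}
    (hL0 : 0 < L) (hL : 2 ≤ L ^ 2) (hδ : 0 < δ) (hδ1 : δ ≤ 1)
    (hLδ : Real.exp (-L ^ 2) ≤ δ / (M + 1) / 4)
    (ha : entropyIntegral H μ n ρ c₁ lam ≠ ⊤) :
    P {o | ∃ g : H, ((M + 1) * (10 * (R + 3) * L * √2 * (c * (2 * R))) * c₁ ^ 2) *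
        ((entropyIntegral H μ n ρ c₁ lam).toReal / √((totalSize n : ℝ) * effDim ρ lam ^ 2)) *
        pooledInner μ n lam g g <
        |pooledMean n (fun m i => W m i o * (g (Xs m i o) * g (Xs m i o))) - pooledForm μ n g g|}
      ≤ ENNReal.ofReal δ := by
  have hc : 0 < c := lt_of_lt_of_le one_pos hW.one_le
  have hn' : (0 : ℝ) < totalSize n := by exact_mod_cast Nat.pos_of_ne_zero hn
  have hd : ∀ ν, 0 < (1 + lam * ρ ν)⁻¹ := fun ν => by
    have := hA2.pos ν
    positivity
  have hh : 0 < effDim ρ lam := inv_pos.2 (hs.tsum_pos (fun ν => (hd ν).le) 0 (hd 0))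
  set F : Set H := scaledBall H μ n ρ c₁ lam
  have hNF : ∀ f ∈ F, pooledInner μ n lam f f ≤ effDim ρ lam / c₁ ^ 2 := by
    intro f hf
    have h1 : √(pooledInner μ n lam f f) ≤ c₁⁻¹ * √(effDim ρ lam) := hf
    rw [Real.sqrt_le_left (by positivity), mul_pow, Real.sq_sqrt hh.le, inv_pow] at h1
    rwa [div_eq_inv_mul]
  have hF0 : (0 : H) ∈ F := by
    change √(pooledInner μ n lam (0 : H) 0) ≤ _
    have : pooledInner μ n lam (0 : H) 0 = 0 := by
      rw [← pooledBilin_apply hK]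
      simp
    rw [this, Real.sqrt_zero]
    positivity
  have hFR : ∀ f ∈ F, ∀ x, |f x| ≤ R := by
    intro f hf x
    have h1 := sq_apply_le_mul_pooledInner hK hA2 hB hn hlam hb h hs f x
    have h2 : f x ^ 2 ≤ (√b * B / c₁) ^ 2 := by
      refine h1.trans ?_
      calc b * (B ^ 2 * (effDim ρ lam)⁻¹) * pooledInner μ n lam f f
          ≤ b * (B ^ 2 * (effDim ρ lam)⁻¹) * (effDim ρ lam / c₁ ^ 2) := by
            gcongr
            exact hNF f hf
        _ = (√b * B / c₁) ^ 2 := by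
            rw [div_pow, mul_pow, Real.sq_sqrt (by linarith)]
            field_simp
    exact (abs_le_of_sq_le_sq h2 (by positivity)).trans hRb
  set a : ℝ := (entropyIntegral H μ n ρ c₁ lam).toReal with ha_def
  have ha0 : 0 ≤ a := ENNReal.toReal_nonneg
  set T : ℝ := 10 * (R + 3) * L * (√(2 * totalSize n) * (c * (2 * R))) * a with hT
  -- the populations are treated one at a time: no independence between them is assumed
  let Z : Fin (M + 1) → Ω → H → ℝ := fun m o f => ∑ i ∈ Finset.range (n m),
    (W m i o * f (Xs m i o) ^ 2 - ∫ x, f x ^ 2 ∂(μ m))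
  have hZ : ∀ m, P {o | ∃ f ∈ F, T < |Z m o f|} ≤ ENNReal.ofReal (δ / (M + 1)) := fun m =>
    measure_exists_sq_deviation_gt_le hdata hW hK.measurable hF0 hR hFR m
      (Finset.single_le_sum (f := n) (fun _ _ => Nat.zero_le _) (Finset.mem_univ m)) hn hL0 hL
      (by positivity) ((div_le_self hδ.le (by
        have : (0 : ℝ) ≤ M := Nat.cast_nonneg M
        linarith)).trans hδ1) hLδ ha
  have hunion : P (⋃ m, {o | ∃ f ∈ F, T < |Z m o f|}) ≤ ENNReal.ofReal δ := by
    refine (measure_iUnion_fintype_le P _).trans ((Finset.sum_le_sum fun m _ => hZ m).trans ?_)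
    rw [← ENNReal.ofReal_sum_of_nonneg fun _ _ => by positivity]
    apply ENNReal.ofReal_le_ofReal
    rw [Finset.sum_const, Finset.card_univ, Fintype.card_fin, nsmul_eq_mul]
    push_cast
    exact le_of_eq (by field_simp)
  refine (measure_mono ?_).trans hunion
  rintro o ⟨g, hg⟩
  by_contra hno
  simp only [Set.mem_iUnion, Set.mem_ofPred_eq, not_exists, not_and, not_lt] at hno
  have hQ : ∀ f : H, pooledMean n (fun m i => W m i o * (f (Xs m i o) * f (Xs m i o)))
      - pooledForm μ n f f = (totalSize n : ℝ)⁻¹ * ∑ m, Z m o f := by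
    intro f
    rw [pooledMean, pooledForm, ← mul_sub, ← Finset.sum_sub_distrib]
    congr 1
    refine Finset.sum_congr rfl fun m _ => ?_
    simp only [Z, quadForm, Finset.sum_sub_distrib, Finset.sum_const, Finset.card_range,
      nsmul_eq_mul, sq]
  have hQF : ∀ f ∈ F, |(totalSize n : ℝ)⁻¹ * ∑ m, Z m o f|
      ≤ (totalSize n : ℝ)⁻¹ * ((M + 1) * T) := by
    intro f hf
    rw [abs_mul, abs_of_pos (inv_pos.2 hn')]
    gcongr
    refine (Finset.abs_sum_le_sum_abs _ _).trans
      ((Finset.sum_le_sum fun m _ => hno m f hf).trans (le_of_eq ?_))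
    simp
  by_cases hg0 : g = 0
  · rw [hQ] at hg
    subst hg0
    have h1 : pooledInner μ n lam (0 : H) 0 = 0 := by
      rw [← pooledBilin_apply hK]
      simp
    simp [h1, Z] at hg
  -- rescale `g` to the boundary of the ball
  have hNg : 0 < pooledInner μ n lam g g := by
    have := norm_pos_iff.2 hg0
    exact lt_of_lt_of_le (by positivity) (lam_mul_sq_le_pooledInner μ n g)
  set s : ℝ := effDim ρ lam / c₁ ^ 2 / pooledInner μ n lam g g with hs_def
  have hs0 : 0 < s := by positivity
  have hf : √s • g ∈ F := by
    change √(pooledInner μ n lam (√s • g) (√s • g)) ≤ _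
    have hscale : pooledInner μ n lam (√s • g) (√s • g) = s * pooledInner μ n lam g g := by
      simp only [← pooledBilin_apply hK, map_smul, LinearMap.smul_apply, smul_eq_mul]
      rw [← mul_assoc, Real.mul_self_sqrt hs0.le]
    rw [hscale, hs_def, div_mul_cancel₀ _ hNg.ne',
      Real.sqrt_div hh.le, Real.sqrt_sq hc₁.le, div_eq_inv_mul]
  have hZs : ∀ m, Z m o (√s • g) = s * Z m o g := by
    intro m
    simp only [Z, RKHS.coe_smul, Pi.smul_apply, smul_eq_mul, mul_pow, Real.sq_sqrt hs0.le]
    rw [Finset.mul_sum, integral_const_mul]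
    refine Finset.sum_congr rfl fun i _ => ?_
    ring
  have h1 := hQF _ hf
  simp only [hZs, ← Finset.mul_sum] at h1
  rw [mul_left_comm, abs_mul, abs_of_pos hs0, ← hQ] at h1
  have hsqrt : √((totalSize n : ℝ) * effDim ρ lam ^ 2) = √(totalSize n : ℝ) * effDim ρ lam := by
    rw [Real.sqrt_mul hn'.le, Real.sqrt_sq hh.le]
  have hinv : (totalSize n : ℝ)⁻¹ * √(totalSize n : ℝ) = (√(totalSize n : ℝ))⁻¹ := by
    have h3 := Real.sqrt_pos.2 hn'
    nth_rewrite 1 [← Real.mul_self_sqrt hn'.le]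
    field_simp
  have h2 : (totalSize n : ℝ)⁻¹ * ((M + 1) * T) =
      s * (((M + 1) * (10 * (R + 3) * L * √2 * (c * (2 * R))) * c₁ ^ 2) *
        (a / √((totalSize n : ℝ) * effDim ρ lam ^ 2)) * pooledInner μ n lam g g) := by
    rw [hT, Real.sqrt_mul (by norm_num : (0 : ℝ) ≤ 2), hsqrt]
    calc (totalSize n : ℝ)⁻¹ * ((M + 1) * (10 * (R + 3) * L *
          (√2 * √(totalSize n : ℝ) * (c * (2 * R))) * a))
        = ((totalSize n : ℝ)⁻¹ * √(totalSize n : ℝ)) *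
          ((M + 1) * (10 * (R + 3) * L * (√2 * (c * (2 * R))) * a)) := by ring
      _ = _ := by
          rw [hinv, hs_def]
          have h3 := Real.sqrt_pos.2 hn'
          field_simp
  rw [h2] at h1
  exact absurd hg (not_lt.2 (le_of_mul_le_mul_left h1 hs0))

end Deviation

/-! ### Rates of convergence -/

section Rates

variable {X H Ω : Type*} [MeasurableSpace X] [MeasurableSpace Ω] {M : ℕ}
  [NormedAddCommGroup H] [InnerProductSpace ℝ H] [RKHS ℝ H X ℝ]

theorem zero_mem_scaledBall (μ : Fin (M + 1) → Measure X) (n : Fin (M + 1) → ℕ)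
    (ρ : ℕ → ℝ) {c₁ : ℝ} (hc₁ : 0 < c₁) (lam : ℝ) : (0 : H) ∈ scaledBall H μ n ρ c₁ lam := by
  change √(pooledInner μ n lam (0 : H) 0) ≤ _
  have : pooledInner μ n lam (0 : H) 0 = 0 := by simp [pooledInner, pooledForm, quadForm]
  rw [this, Real.sqrt_zero]
  positivity

/-- Where the entropy ratio is finite, the sample is nonempty, the series defining `h` converges
and the entropy integral is finite. -/
theorem nondegenerate_of_ratio_ne_top (μ : Fin (M + 1) → Measure X) (n : Fin (M + 1) → ℕ)
    (ρ : ℕ → ℝ) {c₁ : ℝ} (hc₁ : 0 < c₁) (lam : ℝ)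
    (h : entropyIntegral H μ n ρ c₁ lam /
      ENNReal.ofReal √((totalSize n : ℝ) * effDim ρ lam ^ 2) ≠ ⊤) :
    totalSize n ≠ 0 ∧ (Summable fun ν => (1 + lam * ρ ν)⁻¹) ∧
      entropyIntegral H μ n ρ c₁ lam ≠ ⊤ := by
  have h0 : entropyIntegral H μ n ρ c₁ lam ≠ 0 := by
    refine (lt_of_lt_of_le ?_ (ofReal_half_le_lintegral_psi2Inv
      (A := (fun f : H => UniformFun.ofFun (f : X → ℝ)) '' scaledBall H μ n ρ c₁ lam)
      ⟨_, 0, zero_mem_scaledBall μ n ρ hc₁ lam, rfl⟩)).ne'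
    simp
  rw [Ne, ENNReal.div_eq_top, not_or, not_and, not_and_not_right] at h
  have h1 := h.1 h0
  refine ⟨fun hn => h1 (by simp [hn]), ?_, fun htop => ENNReal.ofReal_ne_top (h.2 htop)⟩
  by_contra hs
  exact h1 (by simp [effDim, tsum_eq_zero_of_not_summable hs])

theorem exists_exp_neg_sq_le {ε : ℝ} (hε : 0 < ε) :
    ∃ L : ℝ, 0 < L ∧ 2 ≤ L ^ 2 ∧ Real.exp (-L ^ 2) ≤ ε := by
  refine ⟨√(2 + ε⁻¹), by positivity, ?_, ?_⟩
  · rw [Real.sq_sqrt (by positivity)]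
    linarith [inv_pos.2 hε]
  · rw [Real.sq_sqrt (by positivity), Real.exp_neg]
    refine inv_le_of_inv_le₀ hε ?_
    have := Real.add_one_le_exp (2 + ε⁻¹)
    linarith

/-- A squared error made of variance `V / s` and bias `l * F` is at most a constant times the square
of the rate `s^{-1/2} + l^{1/2}`. -/
theorem variance_add_bias_le_sq {s l V F : ℝ} (hs : 0 < s) (hl : 0 < l) (hV : 0 ≤ V)
    (hF : 0 ≤ F) :
    8 * (V * (1 / s) + l * F) ≤ ((√(8 * (V + F)) + 1) * (1 / √s + √l)) ^ 2 := by
  have h1 : (1 / √s) ^ 2 = 1 / s := by rw [div_pow, one_pow, Real.sq_sqrt hs.le]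
  have h2 := Real.sq_sqrt hl.le
  have h3 : 0 ≤ 1 / √s * √l := by positivity
  have h4 : 1 / s + l ≤ (1 / √s + √l) ^ 2 := by
    rw [add_sq, h1, h2]
    linarith
  have h5 : 8 * (V + F) ≤ (√(8 * (V + F)) + 1) ^ 2 := by
    have := Real.sq_sqrt (by positivity : 0 ≤ 8 * (V + F))
    nlinarith [Real.sqrt_nonneg (8 * (V + F))]
  have h6 : 0 ≤ V * l + F * (1 / s) := by positivity
  calc 8 * (V * (1 / s) + l * F) ≤ 8 * (V + F) * (1 / s + l) := by linarith
    _ ≤ (√(8 * (V + F)) + 1) ^ 2 * (1 / √s + √l) ^ 2 := by gcongr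
    _ = _ := by ring

variable [CompleteSpace H] {P : Measure Ω} [IsProbabilityMeasure P]
  {μ : Fin (M + 1) → Measure X} [∀ m, IsProbabilityMeasure (μ m)] {κ : Kernel X ℝ}
  [IsMarkovKernel κ] {W : Fin (M + 1) → ℕ → Ω → ℝ}
  {Xs : Fin (M + 1) → ℕ → Ω → X} {Ys : Fin (M + 1) → ℕ → Ω → ℝ}

/-- Both rates hold simultaneously off an event of small probability. -/
theorem exists_eventually_measure_rates_fail_le
    (hH : ∀ f : H, Measurable (f : X → ℝ)) (fstar : H) (hfstar : IsCondMean μ κ fstar)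
    (hdata : IsCovariateShiftData P μ κ Xs Ys) (hW : IsAdmissibleWeights P W Xs Ys)
    (hA1 : UniformEquivalence H μ)
    {φ : ℕ → H} {ρ : ℕ → ℝ} (hA2 : SimultaneousDiagonalization (μ 0) φ ρ)
    (hA3 : MomentCondition μ κ fstar) (n : ℕ → Fin (M + 1) → ℕ)
    {lam : ℕ → ℝ} (hlam : ∀ k, 0 < lam k) {c₁ : ℝ} (hc₁ : 0 < c₁)
    (ha : Tendsto (fun k => entropyIntegral H μ (n k) ρ c₁ (lam k) /
        ENNReal.ofReal √((totalSize (n k) : ℝ) * effDim ρ (lam k) ^ 2)) atTop (𝓝 0))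
    {δ : ℝ} (hδ : 0 < δ) (hδ1 : δ ≤ 1) :
    ∃ C₁ C₂ : ℝ, 0 < C₁ ∧ 0 < C₂ ∧ ∀ᶠ k in atTop,
      P {o | ¬ (pooledNorm μ (n k) (lam k)
          (estimator H (n k) (lam k) (fun m i => W m i o) (fun m i => Xs m i o)
            (fun m i => Ys m i o) - fstar)
          ≤ C₁ * (1 / √((totalSize (n k) : ℝ) * effDim ρ (lam k)) + √(lam k)) ∧
        pooledNorm μ (n k) (lam k)
          (estimator H (n k) (lam k) (fun m i => W m i o) (fun m i => Xs m i o)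
            (fun m i => Ys m i o) - fstar
          + score μ (n k) (lam k) (fun m i => W m i o) (fun m i => Xs m i o)
              (fun m i => Ys m i o) fstar)
          ≤ C₂ * ((entropyIntegral H μ (n k) ρ c₁ (lam k)).toReal /
            √((totalSize (n k) : ℝ) * effDim ρ (lam k) ^ 2) *
            (1 / √((totalSize (n k) : ℝ) * effDim ρ (lam k)) + √(lam k))))}
        ≤ ENNReal.ofReal (2 * δ) := by
  obtain ⟨b, hb, hbV⟩ := hA1.exists_le
  obtain ⟨B', hB'⟩ := hA2.bounded
  obtain ⟨B, hB0, hB⟩ : ∃ B : ℝ, 0 ≤ B ∧ ∀ ν x, |φ ν x| ≤ B :=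
    ⟨|B'|, abs_nonneg _, fun ν x => (hB' ν x).trans (le_abs_self _)⟩
  obtain ⟨c, hc⟩ := hW.exists_boundedWeights hdata
  obtain ⟨C, hC0, hC⟩ := hA3.exists_lintegral_le (hH fstar)
  have hc0 : 0 < c := lt_of_lt_of_le one_pos hc.one_le
  have hgood : ∀ᶠ k in atTop, totalSize (n k) ≠ 0 ∧ (Summable fun ν => (1 + lam k * ρ ν)⁻¹) ∧
      entropyIntegral H μ (n k) ρ c₁ (lam k) ≠ ⊤ := by
    filter_upwards [ha.eventually_lt_const ENNReal.zero_lt_top] with k hk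
    exact nondegenerate_of_ratio_ne_top μ (n k) ρ hc₁ (lam k) hk.ne
  -- one nondegenerate index suffices to bound all functions in `H`
  obtain ⟨K, hK⟩ : ∃ K, BoundedEval (X := X) H K := by
    obtain ⟨k, -, hs, -⟩ := hgood.exists
    obtain ⟨K, hK0, hK⟩ := exists_abs_le_mul_norm hA2.pos hA2.basis hA2.inner hA2.bounded
      (summable_inv_of_summable hA2.pos hA2.mono (hlam k) hs)
    exact ⟨K, hH, hK0, hK⟩
  obtain ⟨L, hL0, hL, hLδ⟩ := exists_exp_neg_sq_le (ε := δ / (M + 1) / 4) (by positivity)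
  -- `R` bounds the ball `F` in sup norm, whatever the value of `c₁`; adding `1` keeps it positive
  obtain ⟨R, hR, hRb⟩ : ∃ R : ℝ, 0 < R ∧ √b * B / c₁ ≤ R :=
    ⟨√b * B / c₁ + 1, by positivity, by linarith⟩
  set D : ℝ := (M + 1) * (10 * (R + 3) * L * √2 * (c * (2 * R))) * c₁ ^ 2 with hD
  have hD0 : 0 < D := by positivity
  set V : ℝ := b * ((M + 1) * (c ^ 2 * B ^ 2 * C) / δ) with hV
  have hb0 : 0 < b := by linarith
  have hV0 : 0 ≤ V := by positivity
  set C₁ : ℝ := √(8 * (V + ‖fstar‖ ^ 2)) + 1 with hC₁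
  have hC₁0 : 0 < C₁ := by positivity
  refine ⟨C₁, D * C₁, hC₁0, by positivity, ?_⟩
  have hratio : Tendsto (fun k => (entropyIntegral H μ (n k) ρ c₁ (lam k)).toReal /
      √((totalSize (n k) : ℝ) * effDim ρ (lam k) ^ 2)) atTop (𝓝 0) := by
    have h1 := (ENNReal.tendsto_toReal ENNReal.zero_ne_top).comp ha
    simpa only [Function.comp_def, ENNReal.toReal_div, ENNReal.toReal_ofReal (Real.sqrt_nonneg _),
      ENNReal.toReal_zero] using h1
  have hsmall : ∀ᶠ k in atTop, D * ((entropyIntegral H μ (n k) ρ c₁ (lam k)).toReal /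
      √((totalSize (n k) : ℝ) * effDim ρ (lam k) ^ 2)) < 1 / 2 := by
    have h1 := hratio.const_mul D
    rw [mul_zero] at h1
    exact h1.eventually_lt_const (by norm_num)
  filter_upwards [hgood, hsmall] with k ⟨hn, hs, hatop⟩ hη
  have hn' : (0 : ℝ) < totalSize (n k) := by exact_mod_cast Nat.pos_of_ne_zero hn
  have hd : ∀ ν, 0 < (1 + lam k * ρ ν)⁻¹ := fun ν => by
    have := hA2.pos ν
    have := hlam k
    positivity
  have hh : 0 < effDim ρ (lam k) := inv_pos.2 (hs.tsum_pos (fun ν => (hd ν).le) 0 (hd 0))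
  have hquad := measure_exists_form_deviation_gt_le hdata hc hK hA2 hB0 hB hn (hlam k) hb hbV hs
    hc₁ hR hRb hL0 hL hδ hδ1 hLδ hatop
  have hnoise := measure_noise_gt_le hdata hc hH hfstar hC0 hC hA2.pos hB hn (hlam k) hs hδ
  rw [two_mul, ENNReal.ofReal_add hδ.le hδ.le]
  refine le_trans (measure_mono_ae ?_) ((measure_union_le _ _).trans (add_le_add hquad hnoise))
  filter_upwards [ae_all_iff.2 fun m => ae_all_iff.2 (hc.ae_mem m)] with o hwo hbad
  by_contra hno
  apply hbad
  change o ∉ ({o | _} ∪ {o | _} : Set Ω) at hno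
  simp only [Set.mem_union, Set.mem_ofPred_eq, not_or, not_exists, not_lt] at hno
  obtain ⟨hQ, hT⟩ := hno
  set η : ℝ := D * ((entropyIntegral H μ (n k) ρ c₁ (lam k)).toReal /
      √((totalSize (n k) : ℝ) * effDim ρ (lam k) ^ 2)) with hη_def
  have hη0 : 0 ≤ η := mul_nonneg hD0.le (div_nonneg ENNReal.toReal_nonneg (Real.sqrt_nonneg _))
  have hlin := pooledNorm_linearization_le hK (hlam k) (fun m i => (hwo m i).1.le)
    (fun m i => Xs m i o) (fun m i => Ys m i o) fstar hη0 hQ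
  set d : H := estimator H (n k) (lam k) (fun m i => W m i o) (fun m i => Xs m i o)
            (fun m i => Ys m i o) - fstar
  set S : H := score μ (n k) (lam k) (fun m i => W m i o) (fun m i => Xs m i o)
              (fun m i => Ys m i o) fstar
  have hS := pooledInner_score_self_le hK hA2 hn (hlam k) hb hbV (fun m i => W m i o)
    (fun m i => Xs m i o) (fun m i => Ys m i o) fstar hT
  have hdS := pooledInner_self_le_of_add hK (hlam k) d S
    (hlin.trans (mul_le_mul_of_nonneg_right hη.le (Real.sqrt_nonneg _)))
  have h1 : pooledNorm μ (n k) (lam k) d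
      ≤ C₁ * (1 / √((totalSize (n k) : ℝ) * effDim ρ (lam k)) + √(lam k)) := by
    refine (Real.sqrt_le_left (by positivity)).2 ((hdS.trans (mul_le_mul_of_nonneg_left hS
      (by norm_num))).trans (le_trans (le_of_eq ?_)
      (variance_add_bias_le_sq (mul_pos hn' hh) (hlam k) hV0 (sq_nonneg ‖fstar‖))))
    rw [hV]
    field_simp
    ring
  refine ⟨h1, hlin.trans ?_⟩
  calc η * pooledNorm μ (n k) (lam k) d ≤ η * (C₁ *
          (1 / √((totalSize (n k) : ℝ) * effDim ρ (lam k)) + √(lam k))) :=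
        mul_le_mul_of_nonneg_left h1 hη0
    _ = _ := by rw [hη_def]; ring

end Rates

end PooledKRR

theorem mainTheorem1 {d M : ℕ} (𝒳 : Set (EuclideanSpace ℝ (Fin d)))
    {H : Type*} [NormedAddCommGroup H] [InnerProductSpace ℝ H] [CompleteSpace H]
    [RKHS ℝ H 𝒳 ℝ] (hH : ∀ f : H, Measurable (f : 𝒳 → ℝ))
    {Ω : Type*} [MeasurableSpace Ω] (P : Measure Ω) [IsProbabilityMeasure P]
    (μ : Fin (M + 1) → Measure 𝒳) [∀ m, IsProbabilityMeasure (μ m)]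
    (κ : Kernel 𝒳 ℝ) [IsMarkovKernel κ] (fstar : H) (hfstar : IsCondMean μ κ fstar)
    (Xs : Fin (M + 1) → ℕ → Ω → 𝒳) (Ys W : Fin (M + 1) → ℕ → Ω → ℝ)
    (hdata : IsCovariateShiftData P μ κ Xs Ys)
    (hW : IsAdmissibleWeights P W Xs Ys)
    (hA1 : UniformEquivalence H μ)
    (φ : ℕ → H) (ρ : ℕ → ℝ) (hA2 : SimultaneousDiagonalization (μ 0) φ ρ)
    (hA3 : MomentCondition μ κ fstar)
    (n : ℕ → Fin (M + 1) → ℕ) (hn : Tendsto (fun k => totalSize (n k)) atTop atTop)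
    (lam : ℕ → ℝ) (hlam : ∀ k, 0 < lam k) (c₁ : ℝ) (hc₁ : 0 < c₁)
    (ha : Tendsto (fun k => entropyIntegral H μ (n k) ρ c₁ (lam k) /
        ENNReal.ofReal √((totalSize (n k) : ℝ) * effDim ρ (lam k) ^ 2)) atTop (𝓝 0)) :
    IsBigOInProb P
      (fun k o => pooledNorm μ (n k) (lam k)
        (estimator H (n k) (lam k) (fun m i => W m i o) (fun m i => Xs m i o)
            (fun m i => Ys m i o) - fstar))
      (fun k => 1 / √((totalSize (n k) : ℝ) * effDim ρ (lam k)) + √(lam k)) ∧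
    IsBigOInProb P
      (fun k o => pooledNorm μ (n k) (lam k)
        (estimator H (n k) (lam k) (fun m i => W m i o) (fun m i => Xs m i o)
            (fun m i => Ys m i o) - fstar
          + score μ (n k) (lam k) (fun m i => W m i o) (fun m i => Xs m i o)
              (fun m i => Ys m i o) fstar))
      (fun k => (entropyIntegral H μ (n k) ρ c₁ (lam k)).toReal /
          √((totalSize (n k) : ℝ) * effDim ρ (lam k) ^ 2) *
        (1 / √((totalSize (n k) : ℝ) * effDim ρ (lam k)) + √(lam k))) := by
  have key : ∀ {δ : ℝ}, 0 < δ → δ ≤ 1 → _ := fun {δ} hδ hδ1 =>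
    exists_eventually_measure_rates_fail_le hH fstar hfstar hdata hW hA1 hA2 hA3 n hlam hc₁ ha
      hδ hδ1
  have hmin : ∀ {ε : ℝ}, 0 < ε → 0 < min (ε / 2) 1 ∧ min (ε / 2) 1 ≤ 1 ∧
      ENNReal.ofReal (2 * min (ε / 2) 1) ≤ ENNReal.ofReal ε := fun {ε} hε =>
    ⟨lt_min (by linarith) one_pos, min_le_right _ _,
      ENNReal.ofReal_le_ofReal (by linarith [min_le_left (ε / 2) 1])⟩
  constructor
  · intro ε hε
    obtain ⟨h0, h1, h2⟩ := hmin hε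
    obtain ⟨C₁, C₂, hC₁, hC₂, hk⟩ := key h0 h1
    refine ⟨C₁, hC₁, ?_⟩
    filter_upwards [hk] with k hk
    refine (measure_mono fun o ho => ?_).trans (hk.trans h2)
    rw [Set.mem_ofPred_eq, pooledNorm, abs_of_nonneg (Real.sqrt_nonneg _)] at ho
    exact fun h => absurd ho (not_lt.2 h.1)
  · intro ε hε
    obtain ⟨h0, h1, h2⟩ := hmin hε
    obtain ⟨C₁, C₂, hC₁, hC₂, hk⟩ := key h0 h1
    refine ⟨C₂, hC₂, ?_⟩
    filter_upwards [hk] with k hk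
    refine (measure_mono fun o ho => ?_).trans (hk.trans h2)
    rw [Set.mem_ofPred_eq, pooledNorm, abs_of_nonneg (Real.sqrt_nonneg _)] at ho
    exact fun h => absurd ho (not_lt.2 h.2)
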